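/- A \emph{system} $(X,s)$ is a compact Hausdorff space $X$ with a homeomorphism $s\colon X\to X$. It is \emph{minimal} if $X$ has no proper non-empty closed set $Z$ with $s(Z)=Z$. Its \emph{enveloping semigroup} $E(X,s)$ is the closure of $\{s^n : n\in\mathbb Z\}$ in $X^X$ (product topology); with $\lambda_s(a)=s\circ a$, the pair $(E(X,s),\lambda_s)$ is again a system. $(X,s)$ is \emph{distal} if all members of $E(X,s)$ are injective. A \emph{homomorphism} $(X,s)\to(Y,t)$ is a continuous surjection $\pi\colon X\to Y$ with $\pi\circ s=t\circ\pi$; then $(Y,t)$ is a \emph{factor} of $(X,s)$. Let $\mathbb T$ be the circle group, let $G_0(X,s)$ be the set of constant functions $X\to\mathbb T$ and let $G_{m+1}(X,s)$ be the set of continuous $g\colon X\to\mathbb T$ such that $g\circ s=fg$ for some $f\in G_m(X,s)$. $(X,s)$ has \emph{quasi-discrete spectrum} (QDS) if the linear span of $\bigcup_m G_m(X,s)$ is dense in $C(X,\mathbb C)$ with the supremum norm. Let $H(\mathbb T)$ be the set of all (not necessarily continuous) group endomorphisms of $\mathbb T$, with pointwise multiplication and the topology of pointwise convergence. Let $\mathbb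 T_Q=\{e^{2\pi i q}: q\in\mathbb Q\}$, and let $s(k,j)$ be the Stirling numbers of the first kind, $n(n-1)\cdots(n-k+1)=\sum_{j=0}^k s(k,j)n^j$. Let $\mathcal H\subseteq H(\mathbb T)^{\{0,1,2,\dots\}}$ be the set of the sequences $(\phi_k)_{k\ge0}$ such that $\phi_0=\mathrm{id}$ and $$\phi_k(x^{k!})=\prod_{j=1}^k\phi_1^{(j)}\bigl(x^{s(k,j)}\bigr)\quad\text{for all }x\in\mathbb T_Q,\ k\ge1,$$ where $\phi_1^{(j)}$ is the $j$-fold composition of $\phi_1$. $\mathcal H$ carries the topology induced by the product topology, and is a group under $(\phi\star\psi)_k=\prod_{j=0}^k\phi_{k-j}\circ\psi_j$. Let $T\colon\mathcal H\to\mathcal H$ be the homeomorphism $T(\phi_0,\phi_1,\phi_2,\dots)=(\phi_0,\phi_0\phi_1,\phi_1\phi_2,\dots)$. For $x\in\mathbb T$ let $$\mathcal G_x=\{\phi\in\mathcal H:\ \phi_1(x^2)=1,\ \phi_1(y)=1\text{ for all }y\in\mathbb T_Q,\ \phi_2(x)=1\},$$ which is a subgroup of $\mathcal H$; $T$ induces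 a homeomorphism $\phi\star\mathcal G_x\mapsto T(\phi)\star\mathcal G_x$, again denoted $T$, of the space $\mathcal H/\mathcal G_x$ of left cosets with the quotient topology. \textbf{Theorem.} $(\mathcal H,T)$ is a minimal system (with $\mathcal H$ compact Hausdorff) with QDS. We have $\mathbb T\setminus\mathbb T_Q\neq\emptyset$, and for every $x\in\mathbb T\setminus\mathbb T_Q$ the subgroup $\mathcal G_x$ is closed in $\mathcal H$, the quotient $\mathcal H/\mathcal G_x$ is Hausdorff, the quotient map is a homomorphism from $(\mathcal H,T)$ onto $(\mathcal H/\mathcal G_x,T)$, and the system $(\mathcal H/\mathcal G_x,T)$ is minimal and distal and does not have QDS, although the system on its enveloping semigroup, $(E(\mathcal H/\mathcal G_x,T),\lambda_T)$, has QDS. Consequently, there are a minimal system with QDS and a factor of it without QDS, and there is a minimal distal system $(X,s)$ without QDS for which $(E(X,s),\lambda_s)$ has QDS. -/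

import Mathlib

open Finset.HasAntidiagonal (antidiagonal)

noncomputable section

namespace QDS

/-! ### Topological dynamics

A dynamical system is a homeomorphism `s : X ≃ₜ X` of a compact Hausdorff space `X`. -/

section Dynamics

variable {X : Type*} [TopologicalSpace X] {Y : Type*} [TopologicalSpace Y]

/-- `X` contains no proper, non-empty, closed, invariant set. -/
def IsMinimalSystem (s : X ≃ₜ X) : Prop :=
  ∀ Z : Set X, IsClosed Z → Z.Nonempty → s '' Z = Z → Z = Set.univ

/-- A homomorphism of systems (it is surjective): `(Y, t)` is a factor of `(X, s)` through `π`. -/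
def IsHomomorphism (s : X ≃ₜ X) (t : Y ≃ₜ Y) (π : X → Y) : Prop :=
  Continuous π ∧ Function.Surjective π ∧ ∀ x, π (s x) = t (π x)

/-- The enveloping semigroup `E(X, s)`: the closure in `X ^ X`, with the product topology,
of the set of all iterates `s ^ n`, `n ∈ ℤ`. -/
def envelopingSemigroup (s : X ≃ₜ X) : Set (X → X) :=
  closure (Set.range fun n : ℤ => ((s ^ n : X ≃ₜ X) : X → X))

/-- The members of the enveloping semigroup are injective. -/
def IsDistal (s : X ≃ₜ X) : Prop :=
  ∀ a ∈ envelopingSemigroup s, Function.Injective a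

theorem zpow_comp_mem_envelopingSemigroup (s : X ≃ₜ X) (k : ℤ) {a : X → X}
    (ha : a ∈ envelopingSemigroup s) :
    ((s ^ k : X ≃ₜ X) : X → X) ∘ a ∈ envelopingSemigroup s := by
  have hc : Continuous fun b : X → X => ((s ^ k : X ≃ₜ X) : X → X) ∘ b :=
    continuous_pi fun x => (s ^ k : X ≃ₜ X).continuous.comp (continuous_apply x)
  refine map_mem_closure hc ha ?_
  rintro _ ⟨n, rfl⟩
  exact ⟨k + n, by ext x; simp [zpow_add]⟩

theorem comp_mem_envelopingSemigroup (s : X ≃ₜ X) (a : envelopingSemigroup s) :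
    (s : X → X) ∘ a.1 ∈ envelopingSemigroup s := by
  have h := zpow_comp_mem_envelopingSemigroup s 1 a.2
  rwa [zpow_one] at h

theorem symm_comp_mem_envelopingSemigroup (s : X ≃ₜ X) (a : envelopingSemigroup s) :
    (s.symm : X → X) ∘ a.1 ∈ envelopingSemigroup s := by
  have h := zpow_comp_mem_envelopingSemigroup s (-1) a.2
  rwa [zpow_neg_one] at h

/-- The left translation `λ_s : E(X, s) → E(X, s)`, `a ↦ s ∘ a`. -/
def leftTranslation (s : X ≃ₜ X) : envelopingSemigroup s ≃ₜ envelopingSemigroup s where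
  toFun a := ⟨s ∘ a.1, comp_mem_envelopingSemigroup s a⟩
  invFun a := ⟨s.symm ∘ a.1, symm_comp_mem_envelopingSemigroup s a⟩
  left_inv a := Subtype.ext (funext fun x => s.symm_apply_apply (a.1 x))
  right_inv a := Subtype.ext (funext fun x => s.apply_symm_apply (a.1 x))
  continuous_toFun := Continuous.subtype_mk (continuous_pi fun x =>
    s.continuous.comp ((continuous_apply x).comp continuous_subtype_val)) _
  continuous_invFun := Continuous.subtype_mk (continuous_pi fun x =>
    s.symm.continuous.comp ((continuous_apply x).comp continuous_subtype_val)) _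

/-- The groups `G_m(X, s)`: `G_0(X, s)` consists of the constant functions `X → 𝕋`, and
`G_{m+1}(X, s)` of those continuous `g : X → 𝕋` with `g ∘ s = f g` for some `f ∈ G_m(X, s)`. -/
def quasiEigenfunctions (s : X ≃ₜ X) : ℕ → Set C(X, Circle)
  | 0 => {g | ∃ c : Circle, g = ContinuousMap.const X c}
  | m + 1 => {g | ∃ f ∈ quasiEigenfunctions s m, ∀ x, g (s x) = f x * g x}

/-- Topological quasi-discrete spectrum: the linear span of the quasi-eigenfunctions is dense in
the space of continuous functions `X → ℂ` (whose topology is that of uniform convergence, for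
compact `X`). -/
def HasQuasiDiscreteSpectrum (s : X ≃ₜ X) : Prop :=
  Dense (Submodule.span ℂ
    {h : C(X, ℂ) | ∃ m : ℕ, ∃ g ∈ quasiEigenfunctions s m, ∀ x, h x = (g x : ℂ)} : Set C(X, ℂ))

end Dynamics

/-! ### The space `𝓗` -/

/-- `H(𝕋)`, the set of all (not necessarily continuous) group endomorphisms of the circle. Its
multiplication, an instance from the library, is pointwise. -/
abbrev EndT : Type := Circle →* Circle

/-- `H(𝕋)` carries the topology of pointwise convergence, as a subspace of `𝕋 ^ 𝕋`. -/
instance : TopologicalSpace EndT :=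
  TopologicalSpace.induced (fun φ : EndT => (φ : Circle → Circle)) inferInstance

/-- The rational points `exp(2 π i q)`, `q ∈ ℚ`, of the circle. -/
def TQ : Set Circle := {x | ∃ q : ℚ, x = Circle.exp (2 * Real.pi * q)}

/-- The Stirling number of the first kind `s(k, j)`: the coefficient of `n ^ j` in
`n (n - 1) ⋯ (n - k + 1) = k! * (n choose k)`. -/
def stirling (k j : ℕ) : ℤ := (descPochhammer ℤ k).coeff j

/-- The set `𝓗` of the sequences `φ` in `H(𝕋)` with `φ_0 = id` and
`φ_k (x ^ k!) = ∏_{j=1}^k φ_1^{(j)} (x ^ s(k, j))` for all rational `x` and `k ≥ 1`,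
where `φ_1^{(j)}` is the `j`-fold composition. -/
def ellisSet : Set (ℕ → EndT) :=
  {φ | φ 0 = MonoidHom.id Circle ∧ ∀ k : ℕ, 1 ≤ k → ∀ x ∈ TQ,
    φ k (x ^ k.factorial) = ∏ j ∈ Finset.Icc 1 k, (φ 1)^[j] (x ^ stirling k j)}

/-- The space `𝓗`, a subspace of the product `H(𝕋) ^ ℕ`. -/
abbrev EllisH : Type := ellisSet

/-- `(φ ⋆ ψ)_k = ∏_{i + j = k} φ_i ∘ ψ_j`. -/
def star (φ ψ : ℕ → EndT) : ℕ → EndT :=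
  fun k => ∏ p ∈ antidiagonal k, (φ p.1).comp (ψ p.2)

/-- The left inverse of a sequence with zeroth term `id` for the operation `star`. -/
def starInv (φ : ℕ → EndT) : ℕ → EndT
  | 0 => MonoidHom.id Circle
  | k + 1 => (∏ i : Fin (k + 1), (starInv φ i).comp (φ (k + 1 - i)))⁻¹
decreasing_by exact i.2

/-- The sequence of the power maps `x ↦ x ^ (n choose k)`, `k = 0, 1, 2, …`, for an integer `n`;
in particular `tilde 0 = (id, 1, 1, …)`. -/
def tilde (n : ℤ) : ℕ → EndT := fun k => zpowGroupHom (Ring.choose n k)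

/-- The map `(φ_0, φ_1, φ_2, …) ↦ (φ_0, φ_0 φ_1, φ_1 φ_2, …)`. -/
def shiftMap (φ : ℕ → EndT) : ℕ → EndT
  | 0 => φ 0
  | k + 1 => φ k * φ (k + 1)

/-! Algebra of the operation `star`. -/

theorem star_apply (φ ψ : ℕ → EndT) (k : ℕ) (x : Circle) :
    star φ ψ k x = ∏ p ∈ antidiagonal k, φ p.1 (ψ p.2 x) := by
  simp [star, MonoidHom.finsetProd_apply]

theorem star_assoc (φ ψ χ : ℕ → EndT) : star (star φ ψ) χ = star φ (star ψ χ) := by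
  funext k
  ext1 x
  simp only [star_apply, map_prod]
  rw [Finset.prod_sigma', Finset.prod_sigma']
  refine Finset.prod_nbij' (fun p => ⟨(p.2.1, p.2.2 + p.1.2), (p.2.2, p.1.2)⟩)
    (fun p => ⟨(p.1.1 + p.2.1, p.2.2), (p.1.1, p.2.1)⟩) ?_ ?_ ?_ ?_ ?_
  · rintro ⟨⟨a, b⟩, ⟨c, d⟩⟩; simp; omega
  · rintro ⟨⟨a, b⟩, ⟨c, d⟩⟩; simp; omega
  · rintro ⟨⟨a, b⟩, ⟨c, d⟩⟩; simp
  · rintro ⟨⟨a, b⟩, ⟨c, d⟩⟩; simp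
  · rintro ⟨⟨a, b⟩, ⟨c, d⟩⟩; simp

theorem tilde_zero_zero : tilde 0 0 = MonoidHom.id Circle := by
  ext x; simp [tilde]

theorem tilde_zero_succ (k : ℕ) : tilde 0 (k + 1) = 1 := by
  ext x; simp [tilde]

theorem star_tilde_zero_left (φ : ℕ → EndT) : star (tilde 0) φ = φ := by
  funext k
  rw [star, Finset.prod_eq_single (0, k)]
  · simp [tilde_zero_zero]
  · rintro ⟨a, b⟩ h1 h2
    cases a with
    | zero => simp at h1; simp [h1] at h2
    | succ a => rw [tilde_zero_succ]; ext x; simp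
  · simp

theorem starInv_star (φ : ℕ → EndT) (h : φ 0 = MonoidHom.id Circle) :
    star (starInv φ) φ = tilde 0 := by
  funext k
  cases k with
  | zero => rw [tilde_zero_zero]; simp [star, starInv, h]
  | succ k =>
    rw [tilde_zero_succ, star, Finset.Nat.prod_antidiagonal_eq_prod_range_succ
      (fun i j => (starInv φ i).comp (φ j)), Finset.prod_range_succ]
    simp only [Nat.sub_self, h, MonoidHom.comp_id]
    conv_lhs => rw [starInv]
    rw [← Fin.prod_univ_eq_prod_range (fun i => (starInv φ i).comp (φ (k + 1 - i)))]
    exact mul_inv_cancel _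

theorem tilde_one_succ_succ (k : ℕ) : tilde 1 (k + 2) = 1 := by
  have h : Ring.choose (1 : ℤ) (k + 2) = 0 := by
    have h2 := Ring.choose_natCast (R := ℤ) 1 (k + 2)
    rw [Nat.choose_eq_zero_of_lt (by omega)] at h2
    simpa using h2
  ext x
  simp [tilde, h]

theorem tilde_one_zero : tilde 1 0 = MonoidHom.id Circle := by
  ext x; simp [tilde]

theorem tilde_one_one : tilde 1 1 = MonoidHom.id Circle := by
  ext x; simp [tilde]

theorem shiftMap_eq (φ : ℕ → EndT) : shiftMap φ = star (tilde 1) φ := by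
  funext k
  cases k with
  | zero => simp [shiftMap, star, tilde_one_zero]
  | succ k =>
    rw [star, Finset.Nat.prod_antidiagonal_succ, Finset.prod_eq_single (0, k)]
    · simp [shiftMap, tilde_one_zero, tilde_one_one, mul_comm]
    · rintro ⟨a, b⟩ h1 h2
      cases a with
      | zero => simp at h1; simp [h1] at h2
      | succ a => simp only [tilde_one_succ_succ]; ext x; simp
    · simp

/-! Rational points are the torsion points, and endomorphisms act on them by powers. -/

theorem mem_TQ_iff (x : Circle) : x ∈ TQ ↔ ∃ n : ℕ, 0 < n ∧ x ^ n = 1 := by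
  constructor
  · rintro ⟨q, rfl⟩
    refine ⟨q.den, q.den_pos, ?_⟩
    rw [← Circle.exp_nsmul, Circle.exp_eq_one]
    refine ⟨q.num, ?_⟩
    have h : (q : ℝ) * q.den = q.num := by exact_mod_cast Rat.mul_den_eq_num q
    rw [← h, nsmul_eq_mul]
    ring
  · rintro ⟨n, hn, hx⟩
    obtain ⟨θ, rfl⟩ := Circle.exp_surjective x
    rw [← Circle.exp_nsmul, Circle.exp_eq_one] at hx
    obtain ⟨m, hm⟩ := hx
    refine ⟨m / n, ?_⟩
    congr 1
    have hn' : (n : ℝ) ≠ 0 := by positivity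
    push_cast
    field_simp
    rw [nsmul_eq_mul] at hm
    linarith

theorem exists_zpow (φ : EndT) (N : ℕ) (hN : 0 < N) :
    ∃ m : ℤ, ∀ y : Circle, y ^ N = 1 → φ y = y ^ m := by
  have hN' : (N : ℝ) ≠ 0 := by positivity
  have key : ∀ y : Circle, y ^ N = 1 → ∃ a : ℤ, y = Circle.exp (2 * Real.pi / N) ^ a := by
    intro y hy
    obtain ⟨θ, rfl⟩ := Circle.exp_surjective y
    rw [← Circle.exp_nsmul, Circle.exp_eq_one] at hy
    obtain ⟨a, ha⟩ := hy
    refine ⟨a, ?_⟩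
    rw [← Circle.exp_zsmul]
    congr 1
    rw [nsmul_eq_mul] at ha
    rw [zsmul_eq_mul]
    field_simp
    linarith
  have hζ : Circle.exp (2 * Real.pi / N) ^ N = 1 := by
    rw [← Circle.exp_nsmul, Circle.exp_eq_one]
    exact ⟨1, by rw [nsmul_eq_mul]; field_simp; simp⟩
  obtain ⟨m, hm⟩ := key (φ (Circle.exp (2 * Real.pi / N))) (by rw [← map_pow, hζ, map_one])
  refine ⟨m, fun y hy => ?_⟩
  obtain ⟨a, rfl⟩ := key y hy
  rw [map_zpow, hm, ← zpow_mul, ← zpow_mul, mul_comm m a]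

theorem exists_pow_eq (y : Circle) (n : ℕ) (hn : 0 < n) : ∃ x : Circle, x ^ n = y := by
  obtain ⟨θ, rfl⟩ := Circle.exp_surjective y
  refine ⟨Circle.exp (θ / n), ?_⟩
  rw [← Circle.exp_nsmul, nsmul_eq_mul]
  congr 1
  field_simp

theorem zpow_sum_eq {ι : Type*} (x : Circle) (S : Finset ι) (f : ι → ℤ) :
    x ^ (∑ i ∈ S, f i) = ∏ i ∈ S, x ^ f i := by
  induction S using Finset.cons_induction with
  | empty => simp
  | cons a S ha ih => rw [Finset.sum_cons, Finset.prod_cons, zpow_add, ih]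

theorem sum_stirling (m : ℤ) (k : ℕ) (hk : 1 ≤ k) :
    ∑ j ∈ Finset.Icc 1 k, stirling k j * m ^ j = k.factorial * Ring.choose m k := by
  have h := Ring.descPochhammer_eq_factorial_smul_choose m k
  rw [← Polynomial.eval_eq_smeval, nsmul_eq_mul] at h
  rw [← h, Polynomial.eval_eq_sum_range, descPochhammer_natDegree, Finset.sum_range_succ']
  have h0 : (descPochhammer ℤ k).coeff 0 = 0 := by
    rw [Polynomial.coeff_zero_eq_eval_zero]
    exact descPochhammer_ne_zero_eval_zero _ (by omega)
  rw [h0, zero_mul, add_zero, Finset.range_eq_Ico,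
    Finset.sum_Ico_add' (fun j => (descPochhammer ℤ k).coeff j * m ^ j) 0 k 1]
  rfl

theorem prod_iterate (φ : EndT) (m : ℤ) (k : ℕ) (hk : 1 ≤ k) (x : Circle) (N : ℕ)
    (hm : ∀ y : Circle, y ^ N = 1 → φ y = y ^ m) (hx : x ^ N = 1) :
    ∏ j ∈ Finset.Icc 1 k, φ^[j] (x ^ stirling k j) = (x ^ k.factorial) ^ Ring.choose m k := by
  have hit : ∀ (j : ℕ) (y : Circle), y ^ N = 1 → φ^[j] y = y ^ (m ^ j) := by
    intro j
    induction j with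
    | zero => intro y _; simp
    | succ j ih =>
      intro y hy
      rw [Function.iterate_succ_apply, hm y hy, ih, ← zpow_mul, pow_succ, mul_comm]
      rw [← zpow_natCast, ← zpow_mul, mul_comm, zpow_mul, zpow_natCast, hy, one_zpow]
  rw [← zpow_natCast, ← zpow_mul, ← sum_stirling m k hk, zpow_sum_eq]
  refine Finset.prod_congr rfl fun j _ => ?_
  rw [hit, ← zpow_mul]
  rw [← zpow_natCast, ← zpow_mul, mul_comm, zpow_mul, zpow_natCast, hx, one_zpow]

theorem mem_ellisSet_iff (φ : ℕ → EndT) : φ ∈ ellisSet ↔ φ 0 = MonoidHom.id Circle ∧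
    ∀ N : ℕ, 0 < N → ∀ K : ℕ, ∃ m : ℤ, ∀ k ≤ K, ∀ y : Circle, y ^ N = 1 →
      φ k y = y ^ Ring.choose m k := by
  constructor
  · rintro ⟨h0, h⟩
    refine ⟨h0, fun N hN K => ?_⟩
    obtain ⟨m, hm⟩ := exists_zpow (φ 1) (N * K.factorial) (by positivity)
    refine ⟨m, fun k hk y hy => ?_⟩
    rcases Nat.eq_zero_or_pos k with rfl | hk1
    · simp [h0]
    obtain ⟨x, rfl⟩ := exists_pow_eq y k.factorial (by positivity)
    have hx : x ^ (N * K.factorial) = 1 := by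
      obtain ⟨c, hc⟩ := Nat.factorial_dvd_factorial hk
      have h1 : N * K.factorial = k.factorial * N * c := by rw [hc]; ring
      rw [h1, pow_mul, pow_mul, hy, one_pow]
    rw [h k hk1 x ((mem_TQ_iff x).2 ⟨_, by positivity, hx⟩)]
    exact prod_iterate (φ 1) m k hk1 x _ hm hx
  · rintro ⟨h0, h⟩
    refine ⟨h0, fun k hk x hx => ?_⟩
    obtain ⟨N, hN, hx⟩ := (mem_TQ_iff x).1 hx
    obtain ⟨m, hm⟩ := h N hN k
    rw [prod_iterate (φ 1) m k hk x N (fun y hy => by simpa using hm 1 hk y hy) hx]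
    exact hm k le_rfl _ (by rw [← pow_mul, mul_comm, pow_mul, hx, one_pow])

theorem zpow_pow_eq_one {y : Circle} {N : ℕ} (hy : y ^ N = 1) (a : ℤ) : (y ^ a) ^ N = 1 := by
  rw [← zpow_natCast, ← zpow_mul, mul_comm, zpow_mul, zpow_natCast, hy, one_zpow]

theorem tilde_mem (n : ℤ) : tilde n ∈ ellisSet :=
  (mem_ellisSet_iff _).2 ⟨by ext x; simp [tilde], fun _ _ _ => ⟨n, fun _ _ _ _ => rfl⟩⟩

theorem star_mem {φ ψ : ℕ → EndT} (hφ : φ ∈ ellisSet) (hψ : ψ ∈ ellisSet) :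
    star φ ψ ∈ ellisSet := by
  rw [mem_ellisSet_iff] at *
  refine ⟨by simp [star, hφ.1, hψ.1], fun N hN K => ?_⟩
  obtain ⟨m, hm⟩ := hφ.2 N hN K
  obtain ⟨n, hn⟩ := hψ.2 N hN K
  refine ⟨m + n, fun k hk y hy => ?_⟩
  rw [star_apply, Ring.add_choose_eq k (Commute.all m n), zpow_sum_eq]
  refine Finset.prod_congr rfl fun p hp => ?_
  rw [Finset.HasAntidiagonal.mem_antidiagonal] at hp
  rw [hn _ (by omega) y hy, hm _ (by omega) _ (zpow_pow_eq_one hy _), ← zpow_mul, mul_comm]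

theorem starInv_mem {φ : ℕ → EndT} (hφ : φ ∈ ellisSet) : starInv φ ∈ ellisSet := by
  have h1 := starInv_star φ hφ.1
  rw [mem_ellisSet_iff] at *
  refine ⟨by simp [starInv], fun N hN K => ?_⟩
  obtain ⟨m, hm⟩ := hφ.2 N hN K
  refine ⟨-m, fun k => ?_⟩
  induction k using Nat.strong_induction_on with
  | _ k ih =>
    intro hk y hy
    cases k with
    | zero => simp [starInv]
    | succ k =>
      have h2 := star_apply (starInv φ) φ (k + 1) y
      have h3 := Ring.add_choose_eq (k + 1) (Commute.all (-m) m)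
      rw [neg_add_cancel, Ring.choose_zero_succ] at h3
      have h4 : (1 : Circle) = y ^ (0 : ℤ) := by simp
      rw [h3, zpow_sum_eq] at h4
      rw [h1, tilde_zero_succ, MonoidHom.one_apply, h4,
        Finset.Nat.prod_antidiagonal_succ', Finset.Nat.prod_antidiagonal_succ'] at h2
      simp only [hφ.1, MonoidHom.id_apply, Ring.choose_zero_right, mul_one] at h2
      rw [Finset.prod_congr rfl (g := fun p : ℕ × ℕ => starInv φ p.1 (φ (p.2 + 1) y))] at h2
      · exact (mul_right_cancel h2).symm
      · intro p hp
        rw [Finset.HasAntidiagonal.mem_antidiagonal] at hp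
        rw [hm _ (by omega) y hy, ih _ (by omega) (by omega) _ (zpow_pow_eq_one hy _),
          ← zpow_mul, mul_comm]

/-- The group `(𝓗, ⋆)`. -/
instance : Group EllisH :=
  letI : Mul EllisH := ⟨fun φ ψ => ⟨star φ.1 ψ.1, star_mem φ.2 ψ.2⟩⟩
  letI : One EllisH := ⟨⟨tilde 0, tilde_mem 0⟩⟩
  letI : Inv EllisH := ⟨fun φ => ⟨starInv φ.1, starInv_mem φ.2⟩⟩
  Group.ofLeftAxioms
    (fun φ ψ χ => Subtype.ext (star_assoc φ.1 ψ.1 χ.1))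
    (fun φ => Subtype.ext (star_tilde_zero_left φ.1))
    (fun φ => Subtype.ext (starInv_star φ.1 φ.2.1))

theorem coe_mul (φ ψ : EllisH) : (φ * ψ).1 = star φ.1 ψ.1 := rfl

theorem coe_one : (1 : EllisH).1 = tilde 0 := rfl

/-! The map `T` on `𝓗`, and the maps that it induces on quotients. -/

theorem star_tilde_tilde (m n : ℤ) : star (tilde m) (tilde n) = tilde (m + n) := by
  funext k
  ext1 x
  rw [star_apply]
  simp only [tilde, zpowGroupHom_apply]
  rw [Ring.add_choose_eq k (Commute.all m n), zpow_sum_eq]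
  exact Finset.prod_congr rfl fun p _ => by rw [← zpow_mul, mul_comm]

/-- The element `(x ↦ x ^ (n choose k))_k` of `𝓗`. -/
def tildeH (n : ℤ) : EllisH := ⟨tilde n, tilde_mem n⟩

theorem tildeH_inv : (tildeH 1)⁻¹ = tildeH (-1) := by
  rw [inv_eq_iff_mul_eq_one]
  exact Subtype.ext (star_tilde_tilde 1 (-1))

theorem continuous_eval (k : ℕ) (x : Circle) : Continuous fun φ : EllisH => φ.1 k x :=
  (continuous_apply x).comp (continuous_induced_dom.comp
    ((continuous_apply k).comp continuous_subtype_val))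

theorem continuous_tildeH_mul (n : ℤ) : Continuous fun φ : EllisH => tildeH n * φ := by
  refine Continuous.subtype_mk (continuous_pi fun k => continuous_induced_rng.2
    (continuous_pi fun x => ?_)) _
  simp only [Function.comp_def, star_apply]
  exact continuous_finsetProd _ fun p _ => (continuous_eval p.2 x).zpow _

/-- The homeomorphism `T` of `𝓗`, `T (φ_0, φ_1, φ_2, …) = (φ_0, φ_0 φ_1, φ_1 φ_2, …)`. -/
def T : EllisH ≃ₜ EllisH where
  toFun φ := ⟨shiftMap φ.1, by rw [shiftMap_eq]; exact star_mem (tilde_mem 1) φ.2⟩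
  invFun φ := tildeH (-1) * φ
  left_inv φ := by
    rw [← tildeH_inv, inv_mul_eq_iff_eq_mul]
    exact Subtype.ext (shiftMap_eq φ.1)
  right_inv φ := by
    refine Subtype.ext ((shiftMap_eq _).trans ?_)
    exact congrArg Subtype.val
      (show tildeH 1 * (tildeH (-1) * φ) = φ by rw [← tildeH_inv, mul_inv_cancel_left])
  continuous_toFun := by
    simp only [shiftMap_eq]
    exact continuous_tildeH_mul 1
  continuous_invFun := continuous_tildeH_mul (-1)

theorem T_apply (φ : EllisH) : T φ = tildeH 1 * φ := Subtype.ext (shiftMap_eq φ.1)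

theorem T_symm_apply (φ : EllisH) : T.symm φ = (tildeH 1)⁻¹ * φ := by
  rw [tildeH_inv]; rfl

/-- The homeomorphism `φ 𝓖 ↦ T(φ) 𝓖` of the space `𝓗 / 𝓖` of left cosets, which carries the
quotient topology. -/
def quotientT (G : Subgroup EllisH) : (EllisH ⧸ G) ≃ₜ (EllisH ⧸ G) where
  toFun := Quotient.map' T fun a b h => by
    rw [QuotientGroup.leftRel_apply] at *
    simpa [T_apply, mul_assoc] using h
  invFun := Quotient.map' T.symm fun a b h => by
    rw [QuotientGroup.leftRel_apply] at *
    simpa [T_symm_apply, mul_assoc] using h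
  left_inv q := by
    induction q using QuotientGroup.induction_on with
    | H φ => exact congrArg (QuotientGroup.mk (s := G)) (T.symm_apply_apply φ)
  right_inv q := by
    induction q using QuotientGroup.induction_on with
    | H φ => exact congrArg (QuotientGroup.mk (s := G)) (T.apply_symm_apply φ)
  continuous_toFun := T.continuous.quotient_map' _
  continuous_invFun := T.symm.continuous.quotient_map' _

/-! ### The subgroup `𝓖` -/

theorem mul_apply_one (φ ψ : EllisH) (y : Circle) :
    (φ * ψ).1 1 y = φ.1 1 y * ψ.1 1 y := by
  rw [coe_mul, star_apply]
  simp [Finset.Nat.antidiagonal_succ, φ.2.1, ψ.2.1, mul_comm]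

theorem mul_apply_two (φ ψ : EllisH) (y : Circle) :
    (φ * ψ).1 2 y = φ.1 2 y * φ.1 1 (ψ.1 1 y) * ψ.1 2 y := by
  rw [coe_mul, star_apply]
  simp [Finset.Nat.antidiagonal_succ, φ.2.1, ψ.2.1, mul_comm]

theorem inv_apply_one (φ : EllisH) (y : Circle) : (φ⁻¹).1 1 y = (φ.1 1 y)⁻¹ := by
  rw [eq_inv_iff_mul_eq_one, ← mul_apply_one, inv_mul_cancel, coe_one, tilde_zero_succ]
  rfl

theorem apply_apply_eq_one {φ ψ : EllisH} {x : Circle} (hφ : ∀ y ∈ TQ, φ.1 1 y = 1)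
    (hψ : ψ.1 1 (x ^ 2) = 1) : φ.1 1 (ψ.1 1 x) = 1 :=
  hφ _ ((mem_TQ_iff _).2 ⟨2, two_pos, by rw [← map_pow, hψ]⟩)

/-- The subgroup `𝓖` of `𝓗` of those `φ` for which `φ_1 (x ^ 2) = 1`, `φ_1 (y) = 1` for every
rational `y`, and `φ_2 (x) = 1`. -/
def exampleG (x : Circle) : Subgroup EllisH where
  carrier := {φ | (φ.1 1 (x ^ 2) = 1 ∧ ∀ y ∈ TQ, φ.1 1 y = 1) ∧ φ.1 2 x = 1}
  one_mem' := by
    rw [Set.mem_ofPred_eq, coe_one, tilde_zero_succ, tilde_zero_succ]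
    simp
  mul_mem' := by
    rintro φ ψ ⟨⟨h1, h2⟩, h3⟩ ⟨⟨k1, k2⟩, k3⟩
    refine ⟨⟨?_, fun y hy => ?_⟩, ?_⟩
    · rw [mul_apply_one, h1, k1, one_mul]
    · rw [mul_apply_one, h2 y hy, k2 y hy, one_mul]
    · rw [mul_apply_two, h3, k3, apply_apply_eq_one h2 k1, one_mul, one_mul]
  inv_mem' := by
    rintro φ ⟨⟨h1, h2⟩, h3⟩
    have h4 : ∀ y ∈ TQ, (φ⁻¹).1 1 y = 1 := fun y hy => by rw [inv_apply_one, h2 y hy, inv_one]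
    refine ⟨⟨?_, h4⟩, ?_⟩
    · rw [inv_apply_one, h1, inv_one]
    · have h5 := mul_apply_two φ⁻¹ φ x
      rw [inv_mul_cancel, coe_one, tilde_zero_succ, h3, apply_apply_eq_one h4 h1, mul_one,
        mul_one] at h5
      exact h5.symm

end QDS

namespace QDS

/-! ### Density of the span of a separating group of circle-valued functions -/

section StoneWeierstrass

variable {X : Type*} [TopologicalSpace X]

/-- A circle-valued continuous function as a complex-valued one. -/
def toComplexMap (g : C(X, Circle)) : C(X, ℂ) := ⟨fun x => (g x : ℂ), by fun_prop⟩

@[simp]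
theorem toComplexMap_apply (g : C(X, Circle)) (x : X) : toComplexMap g x = (g x : ℂ) := rfl

theorem toComplexMap_mul (g h : C(X, Circle)) :
    toComplexMap (g * h) = toComplexMap g * toComplexMap h := by
  ext x; simp

theorem toComplexMap_one : toComplexMap (1 : C(X, Circle)) = 1 := by
  ext x; simp

theorem star_toComplexMap (g : C(X, Circle)) :
    Star.star (toComplexMap g) = toComplexMap g⁻¹ := by
  ext x
  exact (Circle.coe_inv_eq_conj (g x)).symm

/-- The image of a group of circle-valued functions, as a submonoid. -/
def toComplexSubmonoid (S : Subgroup C(X, Circle)) : Submonoid C(X, ℂ) where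
  carrier := toComplexMap '' S
  one_mem' := ⟨1, S.one_mem, toComplexMap_one⟩
  mul_mem' := by
    rintro _ _ ⟨g, hg, rfl⟩ ⟨h, hh, rfl⟩
    exact ⟨g * h, S.mul_mem hg hh, toComplexMap_mul g h⟩

theorem dense_span_toComplexMap [CompactSpace X] (S : Subgroup C(X, Circle))
    (hS : ∀ x y : X, x ≠ y → ∃ g ∈ S, g x ≠ g y) :
    Dense (Submodule.span ℂ (toComplexMap '' (S : Set C(X, Circle))) : Set C(X, ℂ)) := by
  let A : StarSubalgebra ℂ C(X, ℂ) :=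
    { Algebra.adjoin ℂ (toComplexMap '' (S : Set C(X, Circle))) with
      star_mem' := by
        intro a ha
        change Star.star a ∈ Algebra.adjoin ℂ _
        refine Algebra.adjoin_induction (p := fun a _ => Star.star a ∈ Algebra.adjoin ℂ
          (toComplexMap '' (S : Set C(X, Circle)))) ?_ ?_ ?_ ?_ ha
        · rintro _ ⟨g, hg, rfl⟩
          rw [star_toComplexMap]
          exact Algebra.subset_adjoin ⟨g⁻¹, S.inv_mem hg, rfl⟩
        · intro r
          rw [← algebraMap_star_comm]
          exact Subalgebra.algebraMap_mem _ _
        · intro a b _ _ ha hb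
          rw [star_add]
          exact add_mem ha hb
        · intro a b _ _ ha hb
          rw [star_mul]
          exact mul_mem hb ha }
  have hA : (A : Set C(X, ℂ)) =
      (Submodule.span ℂ (toComplexMap '' (S : Set C(X, Circle))) : Set C(X, ℂ)) := by
    have h := Algebra.adjoin_eq_span ℂ (toComplexMap '' (S : Set C(X, Circle)))
    have h2 : Submonoid.closure (toComplexMap '' (S : Set C(X, Circle))) =
        toComplexSubmonoid S := (toComplexSubmonoid S).closure_eq
    rw [h2] at h
    exact congrArg (fun M : Submodule ℂ C(X, ℂ) => (M : Set C(X, ℂ))) h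
  have hsep : A.toSubalgebra.SeparatesPoints := by
    intro x y hxy
    obtain ⟨g, hg, hne⟩ := hS x y hxy
    refine ⟨_, ⟨toComplexMap g, Algebra.subset_adjoin ⟨g, hg, rfl⟩, rfl⟩, ?_⟩
    exact fun h => hne (Circle.coe_injective h)
  have h := ContinuousMap.starSubalgebra_topologicalClosure_eq_top_of_separatesPoints A hsep
  rw [← hA, dense_iff_closure_eq, ← StarSubalgebra.topologicalClosure_coe, h]
  rfl

end StoneWeierstrass

/-! ### Quasi-eigenfunctions -/

section Dynamics

variable {X : Type*} [TopologicalSpace X]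

theorem const_mem_quasiEigenfunctions (s : X ≃ₜ X) (m : ℕ) (c : Circle) :
    ContinuousMap.const X c ∈ quasiEigenfunctions s m := by
  induction m generalizing c with
  | zero => exact ⟨c, rfl⟩
  | succ m ih => exact ⟨_, ih 1, fun x => by simp⟩

theorem quasiEigenfunctions_mono_succ (s : X ≃ₜ X) (m : ℕ) :
    quasiEigenfunctions s m ⊆ quasiEigenfunctions s (m + 1) := by
  induction m with
  | zero =>
    rintro _ ⟨c, rfl⟩
    exact const_mem_quasiEigenfunctions s 1 c
  | succ m ih =>
    rintro g ⟨f, hf, h⟩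
    exact ⟨f, ih hf, h⟩

theorem quasiEigenfunctions_mono (s : X ≃ₜ X) : Monotone (quasiEigenfunctions s) :=
  monotone_nat_of_le_succ (quasiEigenfunctions_mono_succ s)

theorem mul_mem_quasiEigenfunctions (s : X ≃ₜ X) (m : ℕ) {g h : C(X, Circle)}
    (hg : g ∈ quasiEigenfunctions s m) (hh : h ∈ quasiEigenfunctions s m) :
    g * h ∈ quasiEigenfunctions s m := by
  induction m generalizing g h with
  | zero =>
    obtain ⟨c, rfl⟩ := hg
    obtain ⟨d, rfl⟩ := hh
    exact ⟨c * d, by ext; simp⟩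
  | succ m ih =>
    obtain ⟨f, hf, h1⟩ := hg
    obtain ⟨k, hk, h2⟩ := hh
    exact ⟨f * k, ih hf hk, fun x => by simp [h1, h2, mul_mul_mul_comm]⟩

theorem inv_mem_quasiEigenfunctions (s : X ≃ₜ X) (m : ℕ) {g : C(X, Circle)}
    (hg : g ∈ quasiEigenfunctions s m) : g⁻¹ ∈ quasiEigenfunctions s m := by
  induction m generalizing g with
  | zero =>
    obtain ⟨c, rfl⟩ := hg
    exact ⟨c⁻¹, by ext; simp⟩
  | succ m ih =>
    obtain ⟨f, hf, h1⟩ := hg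
    exact ⟨f⁻¹, ih hf, fun x => by simp [h1, mul_comm]⟩

/-- The group of all quasi-eigenfunctions. -/
def quasiEigenfunctionGroup (s : X ≃ₜ X) : Subgroup C(X, Circle) where
  carrier := {g | ∃ m, g ∈ quasiEigenfunctions s m}
  one_mem' := ⟨0, 1, rfl⟩
  mul_mem' := by
    rintro g h ⟨m, hg⟩ ⟨n, hh⟩
    exact ⟨max m n, mul_mem_quasiEigenfunctions s _
      (quasiEigenfunctions_mono s (le_max_left m n) hg)
      (quasiEigenfunctions_mono s (le_max_right m n) hh)⟩
  inv_mem' := by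
    rintro g ⟨m, hg⟩
    exact ⟨m, inv_mem_quasiEigenfunctions s m hg⟩

theorem quasiEigenfunctions_span_generators (s : X ≃ₜ X) :
    {h : C(X, ℂ) | ∃ m : ℕ, ∃ g ∈ quasiEigenfunctions s m, ∀ x, h x = (g x : ℂ)} =
      toComplexMap '' (quasiEigenfunctionGroup s : Set C(X, Circle)) := by
  ext h
  constructor
  · rintro ⟨m, g, hg, hx⟩
    exact ⟨g, ⟨m, hg⟩, by ext x; simp [hx]⟩
  · rintro ⟨g, ⟨m, hg⟩, rfl⟩
    exact ⟨m, g, hg, fun x => rfl⟩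

theorem hasQuasiDiscreteSpectrum_of_separates [CompactSpace X] (s : X ≃ₜ X)
    (h : ∀ x y : X, x ≠ y → ∃ m, ∃ g ∈ quasiEigenfunctions s m, g x ≠ g y) :
    HasQuasiDiscreteSpectrum s := by
  rw [HasQuasiDiscreteSpectrum, quasiEigenfunctions_span_generators]
  refine dense_span_toComplexMap _ fun x y hxy => ?_
  obtain ⟨m, g, hg, hne⟩ := h x y hxy
  exact ⟨g, ⟨m, hg⟩, hne⟩

/-- Two points not separated by quasi-eigenfunctions are not separated by any continuous
function, if the spectrum is quasi-discrete. -/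
theorem HasQuasiDiscreteSpectrum.apply_eq {s : X ≃ₜ X} (hs : HasQuasiDiscreteSpectrum s)
    {x y : X} (h : ∀ m, ∀ g ∈ quasiEigenfunctions s m, g x = g y) (f : C(X, ℂ)) : f x = f y := by
  have hc : IsClosed {f : C(X, ℂ) | f x = f y} :=
    isClosed_eq (continuous_eval_const x) (continuous_eval_const y)
  refine hc.closure_subset_iff.2 ?_ (hs f)
  intro k hk
  refine Submodule.span_induction (p := fun k _ => k x = k y) ?_ rfl ?_ ?_ hk
  · rintro k ⟨m, g, hg, hk⟩
    rw [hk, hk, h m g hg]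
  · intro a b _ _ ha hb
    simp [ha, hb]
  · intro c a _ ha
    simp [ha]

theorem comp_mem_quasiEigenfunctions {Y : Type*} [TopologicalSpace Y] {s : X ≃ₜ X} {t : Y ≃ₜ Y}
    (π : C(X, Y)) (hπ : ∀ x, π (s x) = t (π x)) {m : ℕ} {g : C(Y, Circle)}
    (hg : g ∈ quasiEigenfunctions t m) : g.comp π ∈ quasiEigenfunctions s m := by
  induction m generalizing g with
  | zero =>
    obtain ⟨c, rfl⟩ := hg
    exact ⟨c, by ext; simp⟩
  | succ m ih =>
    obtain ⟨f, hf, h⟩ := hg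
    exact ⟨_, ih hf, fun x => by simp [hπ, h]⟩

theorem IsMinimalSystem.of_isHomomorphism {Y : Type*} [TopologicalSpace Y] {s : X ≃ₜ X}
    {t : Y ≃ₜ Y} {π : X → Y} (hs : IsMinimalSystem s) (hπ : IsHomomorphism s t π) :
    IsMinimalSystem t := by
  obtain ⟨hc, hsurj, heq⟩ := hπ
  intro Z hZ hne hinv
  have hmem : ∀ y, t y ∈ Z ↔ y ∈ Z := fun y => by
    conv_lhs => rw [← hinv]
    exact t.injective.mem_set_image
  have h : π ⁻¹' Z = Set.univ := by
    refine hs _ (hZ.preimage hc) (hne.preimage hsurj) ?_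
    ext x
    rw [Homeomorph.image_eq_preimage_symm]
    simp only [Set.mem_preimage]
    rw [← hmem (π (s.symm x)), ← heq, s.apply_symm_apply]
  refine Set.eq_univ_of_forall fun y => ?_
  obtain ⟨x, rfl⟩ := hsurj y
  exact (h ▸ Set.mem_univ x : x ∈ π ⁻¹' Z)

theorem IsMinimalSystem.eq_of_invariant {Y : Type*} [TopologicalSpace Y] [T1Space Y]
    {s : X ≃ₜ X} (hs : IsMinimalSystem s) {f : X → Y} (hf : Continuous f)
    (h : ∀ x, f (s x) = f x) (x y : X) : f x = f y := by
  have h1 : f ⁻¹' {f y} = Set.univ := by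
    refine hs _ (isClosed_singleton.preimage hf) ⟨y, rfl⟩ ?_
    ext z
    rw [Homeomorph.image_eq_preimage_symm]
    simp only [Set.mem_preimage, Set.mem_singleton_iff]
    rw [← h (s.symm z), s.apply_symm_apply]
  exact (h1 ▸ Set.mem_univ x : x ∈ f ⁻¹' {f y})

/-! Quasi-eigenfunctions of a minimal system that are close to `1` are constant. -/

theorem circle_eq_one_of_norm_pow_sub_one_le {c : Circle}
    (h : ∀ n : ℕ, ‖((c ^ n : Circle) : ℂ) - 1‖ ≤ 1 / 2) : c = 1 := by
  have hgrow : ∀ n : ℕ, (3 / 2 : ℝ) ^ n * ‖(c : ℂ) - 1‖ ≤ ‖((c ^ (2 ^ n) : Circle) : ℂ) - 1‖ := by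
    intro n
    induction n with
    | zero => simp
    | succ n ih =>
      set d := c ^ (2 ^ n) with hd
      have h1 : c ^ (2 ^ (n + 1)) = d * d := by rw [hd, ← pow_add]; congr 1; ring
      have h2 : ((d * d : Circle) : ℂ) - 1 = ((d : ℂ) + 1) * ((d : ℂ) - 1) := by
        push_cast; ring
      have h3 : 3 / 2 ≤ ‖(d : ℂ) + 1‖ := by
        have h4 : ‖(2 : ℂ)‖ ≤ ‖(d : ℂ) + 1‖ + ‖(d : ℂ) - 1‖ := by
          have := norm_sub_le ((d : ℂ) + 1) ((d : ℂ) - 1)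
          rwa [show (d : ℂ) + 1 - ((d : ℂ) - 1) = 2 by ring] at this
        have h5 := h (2 ^ n)
        rw [Complex.norm_ofNat] at h4
        rw [← hd] at h5
        linarith
      rw [h1, h2, norm_mul, pow_succ, mul_comm _ (3 / 2 : ℝ), mul_assoc]
      exact mul_le_mul h3 ih (by positivity) (by positivity)
  by_contra hc
  have hpos : 0 < ‖(c : ℂ) - 1‖ := by
    rw [norm_pos_iff, sub_ne_zero]
    exact fun h => hc (Circle.coe_injective (h.trans Circle.coe_one.symm))
  obtain ⟨n, hn⟩ := pow_unbounded_of_one_lt (1 / ‖(c : ℂ) - 1‖) (by norm_num : (1 : ℝ) < 3 / 2)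
  rw [div_lt_iff₀ hpos] at hn
  linarith [hgrow n, h (2 ^ n)]

theorem norm_coe_mul_inv_sub_one (a b : Circle) :
    ‖((a * b⁻¹ : Circle) : ℂ) - 1‖ = ‖(a : ℂ) - b‖ := by
  have h : ((a * b⁻¹ : Circle) : ℂ) - 1 = ((a : ℂ) - b) * ((b⁻¹ : Circle) : ℂ) := by
    rw [sub_mul, ← Circle.coe_mul, ← Circle.coe_mul, mul_inv_cancel, Circle.coe_one]
  rw [h, norm_mul, Circle.norm_coe, mul_one]

theorem IsMinimalSystem.eq_of_quasiEigenfunction_near_one {s : X ≃ₜ X} (hs : IsMinimalSystem s)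
    {m : ℕ} {g : C(X, Circle)} (hg : g ∈ quasiEigenfunctions s m)
    (h : ∀ x, ‖(g x : ℂ) - 1‖ ≤ (1 / 2) ^ (m + 2)) (x y : X) : g x = g y := by
  induction m generalizing g x y with
  | zero =>
    obtain ⟨c, rfl⟩ := hg
    rfl
  | succ m ih =>
    obtain ⟨f, hf, hfg⟩ := hg
    have hnear : ∀ a b, ‖(g a : ℂ) - g b‖ ≤ (1 / 2) ^ (m + 2) := fun a b => by
      have h1 := norm_sub_le ((g a : ℂ) - 1) ((g b : ℂ) - 1)
      rw [sub_sub_sub_cancel_right] at h1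
      have h2 := h a
      have h3 := h b
      have h4 : (1 / 2 : ℝ) ^ (m + 1 + 2) = (1 / 2) ^ (m + 2) * (1 / 2) := pow_succ _ _
      linarith
    have hfx : ∀ a, f a = g (s a) * (g a)⁻¹ := fun a => by rw [hfg, mul_inv_cancel_right]
    have hconst : ∀ a b, f a = f b := ih hf fun a => by
      rw [hfx, norm_coe_mul_inv_sub_one]
      exact hnear _ _
    have hiter : ∀ n : ℕ, g (s^[n] x) = f x ^ n * g x := by
      intro n
      induction n with
      | zero => simp
      | succ n ihn =>
        rw [Function.iterate_succ_apply', hfg, ihn, hconst _ x, pow_succ', mul_assoc]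
    have h1 : f x = 1 := by
      refine circle_eq_one_of_norm_pow_sub_one_le fun n => ?_
      have h2 : f x ^ n = g (s^[n] x) * (g x)⁻¹ := by rw [hiter, mul_inv_cancel_right]
      rw [h2, norm_coe_mul_inv_sub_one]
      refine (hnear _ _).trans ?_
      calc (1 / 2 : ℝ) ^ (m + 2) ≤ (1 / 2) ^ 1 :=
            pow_le_pow_of_le_one (by norm_num) (by norm_num) (by omega)
        _ = 1 / 2 := pow_one _
    exact hs.eq_of_invariant g.continuous (fun a => by rw [hfg, hconst a x, h1, one_mul]) x y

end Dynamics

/-! ### The compact group of endomorphisms of the circle -/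

theorem EndT.isEmbedding_coe : Topology.IsEmbedding (fun φ : EndT => (φ : Circle → Circle)) :=
  ⟨⟨rfl⟩, DFunLike.coe_injective⟩

theorem EndT.continuous_eval (x : Circle) : Continuous fun φ : EndT => φ x :=
  (continuous_apply x).comp EndT.isEmbedding_coe.continuous

theorem EndT.continuous_of_eval {X : Type*} [TopologicalSpace X] {f : X → EndT}
    (h : ∀ x, Continuous fun a => f a x) : Continuous f :=
  continuous_induced_rng.2 (continuous_pi h)

instance : T2Space EndT := EndT.isEmbedding_coe.t2Space

instance : CompactSpace EndT := by
  refine (Topology.IsClosedEmbedding.mk EndT.isEmbedding_coe ?_).compactSpace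
  have h : Set.range (fun φ : EndT => (φ : Circle → Circle)) =
      ⋂ x : Circle, ⋂ y : Circle, {f : Circle → Circle | f (x * y) = f x * f y} := by
    ext f
    simp only [Set.mem_range, Set.mem_iInter, Set.mem_ofPred_eq]
    constructor
    · rintro ⟨φ, rfl⟩ x y
      exact map_mul φ x y
    · intro hf
      exact ⟨MonoidHom.mk' f hf, rfl⟩
  rw [h]
  exact isClosed_iInter fun x => isClosed_iInter fun y => isClosed_eq (continuous_apply _)
    ((continuous_apply x).mul (continuous_apply y))

instance : IsTopologicalGroup EndT where
  continuous_mul := EndT.continuous_of_eval fun x =>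
    ((EndT.continuous_eval x).comp continuous_fst).mul
      ((EndT.continuous_eval x).comp continuous_snd)
  continuous_inv := EndT.continuous_of_eval fun x => (EndT.continuous_eval x).inv

/-- Evaluation at a point, as a character of the group of endomorphisms. -/
def evalHom : Circle →* C(EndT, Circle) where
  toFun x := ⟨fun φ => φ x, EndT.continuous_eval x⟩
  map_one' := by ext φ; simp
  map_mul' x y := by ext φ; simp

theorem evalHom_apply (x : Circle) (φ : EndT) : evalHom x φ = φ x := rfl

/-- A non-trivial character of a group has integral zero for every invariant measure. -/
theorem integral_character_eq_zero {G : Type*} [Group G] [MeasurableSpace G] [MeasurableMul G]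
    (μ : MeasureTheory.Measure G) [μ.IsMulLeftInvariant] (κ : G →* Circle) {b : G}
    (hb : κ b ≠ 1) : ∫ a, (κ a : ℂ) ∂μ = 0 := by
  have h := MeasureTheory.integral_mul_left_eq_self (μ := μ) (fun a => (κ a : ℂ)) b
  simp only [map_mul, Circle.coe_mul, MeasureTheory.integral_const_mul] at h
  have h2 : ((κ b : ℂ) - 1) * ∫ a, (κ a : ℂ) ∂μ = 0 := by rw [sub_mul, h, one_mul, sub_self]
  refine (mul_eq_zero.1 h2).resolve_left fun h3 => hb ?_
  exact Circle.coe_injective ((sub_eq_zero.1 h3).trans Circle.coe_one.symm)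

/-- A closed subgroup of the group of endomorphisms is the annihilator of its annihilator. -/
theorem mem_of_annihilator (B : Subgroup EndT) (hB : IsClosed (B : Set EndT)) (χ : EndT)
    (h : ∀ x : Circle, (∀ b ∈ B, b x = 1) → χ x = 1) : χ ∈ B := by
  by_contra hχ
  let : MeasurableSpace B := borel B
  have : BorelSpace B := ⟨rfl⟩
  have : CompactSpace B := isCompact_iff_compactSpace.1 hB.isCompact
  let μ : MeasureTheory.Measure B := MeasureTheory.Measure.haar
  have hcont : ∀ (p : C(EndT, ℂ)) (c : EndT), Continuous fun b : B => p (c * b) := fun p c =>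
    p.continuous.comp (continuous_const.mul continuous_subtype_val)
  have hint : ∀ (p : C(EndT, ℂ)) (c : EndT), MeasureTheory.Integrable (fun b : B => p (c * b)) μ :=
    fun p c => (hcont p c).integrable_of_hasCompactSupport
      (HasCompactSupport.of_compactSpace _)
  have hdense := dense_span_toComplexMap (evalHom.range) (by
    intro φ ψ hne
    obtain ⟨x, hx⟩ := DFunLike.ne_iff.1 hne
    exact ⟨_, ⟨x, rfl⟩, hx⟩)
  have hzero : ∀ p ∈ Submodule.span ℂ (toComplexMap '' (evalHom.range : Set C(EndT, Circle))),
      ∫ b : B, p (1 * b) ∂μ = ∫ b : B, p (χ * b) ∂μ := by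
    intro p hp
    refine Submodule.span_induction
      (p := fun p _ => ∫ b : B, p (1 * b) ∂μ = ∫ b : B, p (χ * b) ∂μ) ?_ ?_ ?_ ?_ hp
    · rintro _ ⟨_, ⟨x, rfl⟩, rfl⟩
      simp only [toComplexMap_apply, evalHom_apply, MonoidHom.mul_apply, Circle.coe_mul,
        MeasureTheory.integral_const_mul]
      by_cases hx : ∀ b ∈ B, b x = 1
      · rw [h x hx]
        simp
      · push Not at hx
        obtain ⟨b, hb, hne⟩ := hx
        have h0 : ∫ b : B, ((b.1 x : Circle) : ℂ) ∂μ = 0 :=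
          integral_character_eq_zero μ ((MonoidHom.eval x).comp B.subtype) (b := ⟨b, hb⟩) hne
        rw [h0, mul_zero, mul_zero]
    · simp
    · intro p q _ _ hp hq
      simp only [ContinuousMap.add_apply]
      rw [MeasureTheory.integral_add (hint p 1) (hint q 1),
        MeasureTheory.integral_add (hint p χ) (hint q χ), hp, hq]
    · intro c p _ hp
      simp only [ContinuousMap.smul_apply, smul_eq_mul, MeasureTheory.integral_const_mul, hp]
  have hdisj : Disjoint (B : Set EndT) ((fun b => χ * b) '' (B : Set EndT)) := by
    rw [Set.disjoint_left]
    rintro _ hb ⟨b, hb', rfl⟩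
    exact hχ ((B.mul_mem_cancel_right hb').1 hb)
  obtain ⟨f, hf0, hf1, -⟩ := exists_continuous_zero_one_of_isClosed hB
    ((Homeomorph.mulLeft χ).isClosedMap _ hB) hdisj
  let F : C(EndT, ℂ) := ⟨fun φ => (f φ : ℂ), by fun_prop⟩
  obtain ⟨p, hp, hpF⟩ := Metric.dense_iff.1 hdense F (1 / 3) (by norm_num)
  rw [Metric.mem_ball, dist_eq_norm] at hp
  have hnear : ∀ φ, ‖p φ - F φ‖ ≤ 1 / 3 := fun φ =>
    ((p - F).norm_coe_le_norm φ).trans hp.le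
  have hbound : ∀ b : B, ‖p (1 * b) - p (χ * b) + 1‖ ≤ 2 / 3 := fun b => by
    have h1 := hnear (1 * b)
    have h2 := hnear (χ * b)
    have h3 : F (1 * b) = 0 := by
      rw [one_mul]
      exact congrArg ((↑) : ℝ → ℂ) (hf0 b.2)
    have h4 : F (χ * b) = 1 := 
      (congrArg ((↑) : ℝ → ℂ) (hf1 (Set.mem_image_of_mem _ b.2))).trans Complex.ofReal_one
    rw [h3, sub_zero] at h1
    rw [h4] at h2
    calc ‖p (1 * b) - p (χ * b) + 1‖ = ‖p (1 * b) - (p (χ * b) - 1)‖ := by congr 1; ring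
      _ ≤ _ := norm_sub_le _ _
      _ ≤ 2 / 3 := by linarith
  have h1 := MeasureTheory.norm_integral_le_of_norm_le_const (μ := μ) (.of_forall hbound)
  rw [MeasureTheory.integral_add (f := fun b : B => p (1 * b) - p (χ * b))
    ((hint p 1).sub (hint p χ)) (MeasureTheory.integrable_const _),
    MeasureTheory.integral_sub (hint p 1) (hint p χ), hzero p hpF, sub_self, zero_add,
    MeasureTheory.integral_const, norm_smul, norm_one, mul_one,
    Real.norm_of_nonneg MeasureTheory.measureReal_nonneg] at h1
  have h2 : 0 < μ.real Set.univ :=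
    ENNReal.toReal_pos (isOpen_univ.measure_ne_zero μ Set.univ_nonempty) (MeasureTheory.measure_ne_top _ _)
  linarith

/-! ### Endomorphisms with prescribed values -/

theorem exp_mem_TQ_iff (θ : ℝ) : Circle.exp θ ∈ TQ ↔ ∃ q : ℚ, θ = q * (2 * Real.pi) := by
  constructor
  · rintro ⟨q, hq⟩
    obtain ⟨m, hm⟩ := Circle.exp_eq_exp.1 hq
    exact ⟨q + m, by rw [hm]; push_cast; ring⟩
  · rintro ⟨q, rfl⟩
    exact ⟨q, by rw [mul_comm]⟩

theorem exists_notMem_TQ : ∃ x : Circle, x ∉ TQ := by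
  refine ⟨Circle.exp (2 * Real.pi * Real.sqrt 2), fun h => ?_⟩
  obtain ⟨q, hq⟩ := (exp_mem_TQ_iff _).1 h
  rw [mul_comm] at hq
  exact irrational_sqrt_two ⟨q, (mul_right_cancel₀ (by positivity) hq).symm⟩

/-- A point of the circle of infinite order has an additive functional that takes any value. -/
theorem exists_functional {x : Circle} (hx : x ∉ TQ) (c : ℝ) : ∃ f : Circle → ℝ,
    (∀ y z, f (y * z) = f y + f z) ∧ (∀ y ∈ TQ, f y = 0) ∧ f x = c := by
  obtain ⟨ξ, rfl⟩ := Circle.exp_surjective x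
  have hξ : ξ ∉ Submodule.span ℚ {2 * Real.pi} := by
    rw [Submodule.mem_span_singleton]
    rintro ⟨q, hq⟩
    refine hx ((exp_mem_TQ_iff ξ).2 ⟨q, ?_⟩)
    rw [← hq, Rat.smul_def]
  obtain ⟨g, hg, hgc⟩ := LinearMap.exists_extend_of_notMem
    (0 : Submodule.span ℚ {2 * Real.pi} →ₗ[ℚ] ℝ) hξ c
  have hperiod : ∀ q : ℚ, g (q * (2 * Real.pi)) = 0 := fun q => by
    rw [← Rat.smul_def]
    exact congr($hg ⟨_, Submodule.smul_mem _ q (Submodule.mem_span_singleton_self _)⟩)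
  have hwell : ∀ {a b : ℝ}, Circle.exp a = Circle.exp b → g a = g b := fun {a b} hab => by
    obtain ⟨m, hm⟩ := Circle.exp_eq_exp.1 hab
    rw [hm, map_add, ← Rat.cast_intCast, hperiod, add_zero]
  choose L hL using Circle.exp_surjective
  refine ⟨fun y => g (L y), fun y z => ?_, ?_, ?_⟩
  · rw [← map_add]
    exact hwell (by rw [Circle.exp_add, hL, hL, hL])
  · intro y hy
    rw [← hL y] at hy
    obtain ⟨q, hq⟩ := (exp_mem_TQ_iff _).1 hy
    change g (L y) = 0
    rw [hq, hperiod]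
  · rw [← hgc]
    exact hwell (hL _)

theorem exists_endT_eq {x : Circle} (hx : x ∉ TQ) (z : Circle) :
    ∃ χ : EndT, (∀ y ∈ TQ, χ y = 1) ∧ χ x = z := by
  obtain ⟨θ, rfl⟩ := Circle.exp_surjective z
  obtain ⟨f, hf, hQ, hfx⟩ := exists_functional hx θ
  refine ⟨MonoidHom.mk' (fun y => Circle.exp (f y)) fun y z => by rw [hf, Circle.exp_add],
    fun y hy => ?_, ?_⟩
  · simp [hQ y hy]
  · simp [hfx]

/-- The point `-1` of the circle. -/
def negOne : Circle := Circle.exp Real.pi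

theorem negOne_mul_self : negOne * negOne = 1 := by
  rw [negOne, ← Circle.exp_add, Circle.exp_eq_one]
  exact ⟨1, by push_cast; ring⟩

theorem coe_negOne : (negOne : ℂ) = -1 := by
  simp [negOne, Circle.coe_exp]

theorem negOne_ne_one : negOne ≠ 1 := fun h => by
  have h2 := congrArg (fun z : Circle => (z : ℂ)) h
  simp only [coe_negOne, Circle.coe_one] at h2
  norm_num at h2

theorem negOne_mem_TQ : negOne ∈ TQ :=
  (mem_TQ_iff _).2 ⟨2, two_pos, by rw [pow_two, negOne_mul_self]⟩

theorem eq_one_or_negOne {y : Circle} (h : y * y = 1) : y = 1 ∨ y = negOne := by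
  have h2 : (y : ℂ) * y = 1 := by rw [← Circle.coe_mul, h, Circle.coe_one]
  rcases mul_self_eq_one_iff.1 h2 with h3 | h3
  · exact Or.inl (Circle.coe_injective (h3.trans Circle.coe_one.symm))
  · exact Or.inr (Circle.coe_injective (h3.trans coe_negOne.symm))

theorem exists_endT_negOne {x : Circle} (hx : x ∉ TQ) :
    ∃ χ : EndT, χ negOne = negOne ∧ χ x = 1 := by
  obtain ⟨χ, hQ, hχ⟩ := exists_endT_eq hx x⁻¹
  refine ⟨χ * MonoidHom.id Circle, ?_, ?_⟩
  · simp [hQ _ negOne_mem_TQ]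
  · simp [hχ]

/-! ### Topology of `𝓗` -/

theorem EllisH.continuous_of_eval {X : Type*} [TopologicalSpace X] {f : X → EllisH}
    (h : ∀ k x, Continuous fun a => (f a).1 k x) : Continuous f :=
  Continuous.subtype_mk (continuous_pi fun k => EndT.continuous_of_eval (h k)) _

theorem EllisH.continuous_mul_right (ψ : EllisH) : Continuous fun φ : EllisH => φ * ψ := by
  refine EllisH.continuous_of_eval fun k x => ?_
  simp only [coe_mul, star_apply]
  exact continuous_finsetProd _ fun p _ => continuous_eval p.1 _

theorem EllisH.ext {φ ψ : EllisH} (h : ∀ k x, φ.1 k x = ψ.1 k x) : φ = ψ :=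
  Subtype.ext (funext fun k => MonoidHom.ext (h k))

theorem exists_natCast_exponent {φ : ℕ → EndT} (hφ : φ ∈ ellisSet) {N : ℕ} (hN : 0 < N)
    (K : ℕ) : ∃ m < N * K.factorial, ∀ k ≤ K, ∀ y : Circle, y ^ N = 1 →
      φ k y = y ^ Ring.choose (m : ℤ) k := by
  obtain ⟨h0, h⟩ := hφ
  have hpos : 0 < N * K.factorial := by positivity
  obtain ⟨m', hm'⟩ := exists_zpow (φ 1) (N * K.factorial) hpos
  set M : ℤ := ((N * K.factorial : ℕ) : ℤ) with hM
  have hMpos : 0 < M := Int.natCast_pos.2 hpos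
  obtain ⟨m, hm⟩ := Int.eq_ofNat_of_zero_le (Int.emod_nonneg m' hMpos.ne')
  have hlt : m < N * K.factorial := by
    have := Int.emod_lt_of_pos m' hMpos
    rw [hm, hM] at this
    exact_mod_cast this
  have hφ1 : ∀ y : Circle, y ^ (N * K.factorial) = 1 → φ 1 y = y ^ (m : ℤ) := fun y hy => by
    rw [hm' y hy, ← Int.emod_add_mul_ediv m' M, hm, zpow_add, zpow_mul, hM, zpow_natCast y (N * _),
      hy, one_zpow, mul_one]
  refine ⟨m, hlt, fun k hk y hy => ?_⟩
  rcases Nat.eq_zero_or_pos k with rfl | hk1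
  · simp [h0]
  obtain ⟨x, rfl⟩ := exists_pow_eq y k.factorial (by positivity)
  have hx : x ^ (N * K.factorial) = 1 := by
    obtain ⟨c, hc⟩ := Nat.factorial_dvd_factorial hk
    have h1 : N * K.factorial = k.factorial * N * c := by rw [hc]; ring
    rw [h1, pow_mul, pow_mul, hy, one_pow]
  rw [h k hk1 x ((mem_TQ_iff x).2 ⟨_, hpos, hx⟩)]
  exact prod_iterate (φ 1) m k hk1 x _ hφ1 hx

theorem isClosed_ellisSet : IsClosed ellisSet := by
  have h : ellisSet = {φ | φ 0 = MonoidHom.id Circle} ∩ ⋂ (N : ℕ) (_ : 0 < N) (K : ℕ),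
      ⋃ m ∈ Finset.range (N * K.factorial), ⋂ (k : ℕ) (_ : k ≤ K) (y : Circle) (_ : y ^ N = 1),
        {φ : ℕ → EndT | φ k y = y ^ Ring.choose (m : ℤ) k} := by
    ext φ
    simp only [Set.mem_inter_iff, Set.mem_iInter, Set.mem_iUnion, Set.mem_ofPred_eq,
      Finset.mem_range, exists_prop]
    constructor
    · intro hφ
      exact ⟨hφ.1, fun N hN K => exists_natCast_exponent hφ hN K⟩
    · rintro ⟨h0, h⟩
      refine (mem_ellisSet_iff φ).2 ⟨h0, fun N hN K => ?_⟩
      obtain ⟨m, -, hm⟩ := h N hN K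
      exact ⟨m, hm⟩
  rw [h]
  refine (isClosed_eq (continuous_apply 0) continuous_const).inter ?_
  refine isClosed_iInter fun N => isClosed_iInter fun _ => isClosed_iInter fun K => ?_
  refine isClosed_biUnion_finset fun m _ => ?_
  refine isClosed_iInter fun k => isClosed_iInter fun _ => isClosed_iInter fun y =>
    isClosed_iInter fun _ => ?_
  exact isClosed_eq ((EndT.continuous_eval y).comp (continuous_apply k)) continuous_const

instance : CompactSpace EllisH := isCompact_iff_compactSpace.1 isClosed_ellisSet.isCompact

/-- Sequences whose positive terms are trivial on the rational points belong to `𝓗`. -/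
theorem mem_ellisSet_of_trivial {φ : ℕ → EndT} (h0 : φ 0 = MonoidHom.id Circle)
    (h : ∀ k, ∀ y ∈ TQ, φ (k + 1) y = 1) : φ ∈ ellisSet := by
  refine (mem_ellisSet_iff φ).2 ⟨h0, fun N hN K => ⟨0, fun k _ y hy => ?_⟩⟩
  cases k with
  | zero => simp [h0]
  | succ k => rw [h k y ((mem_TQ_iff y).2 ⟨N, hN, hy⟩), Ring.choose_zero_succ, zpow_zero]

theorem apply_eq_one_of_apply_one (φ : EllisH) (h : ∀ y ∈ TQ, φ.1 1 y = 1) (k : ℕ) {y : Circle}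
    (hy : y ∈ TQ) : φ.1 (k + 1) y = 1 := by
  obtain ⟨x, rfl⟩ := exists_pow_eq y (k + 1).factorial (by positivity)
  have hx : x ∈ TQ := by
    rw [mem_TQ_iff] at hy ⊢
    obtain ⟨n, hn, h1⟩ := hy
    exact ⟨(k + 1).factorial * n, by positivity, by rw [pow_mul, h1]⟩
  rw [φ.2.2 (k + 1) (by omega) x hx]
  refine Finset.prod_eq_one fun j hj => ?_
  obtain ⟨i, rfl⟩ : ∃ i, j = i + 1 := ⟨j - 1, by have := (Finset.mem_Icc.1 hj).1; omega⟩
  rw [Function.iterate_succ_apply, map_zpow, h x hx, one_zpow]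
  exact iterate_map_one (φ.1 1) i

/-! ### The filtration of `𝓗` -/

/-- The elements whose terms of index `1, …, K - 1` are trivial. -/
def filtration (K : ℕ) : Set EllisH := {φ | ∀ j, 1 ≤ j → j < K → φ.1 j = 1}

section Filtration

variable {K : ℕ} {φ : EllisH}

theorem mul_apply_eq (φ ψ : EllisH) (k : ℕ) :
    (φ * ψ).1 k = ∏ p ∈ antidiagonal k, (φ.1 p.1).comp (ψ.1 p.2) := rfl

theorem comp_eq_one_of_filtration (hφ : φ ∈ filtration K) (ψ : EllisH) {i j : ℕ}
    (hi : 1 ≤ i) (hK : i < K) : (φ.1 i).comp (ψ.1 j) = 1 := by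
  rw [hφ i hi hK, MonoidHom.one_comp]

theorem filtration_mul_apply_of_lt (hφ : φ ∈ filtration K) (ψ : EllisH) {k : ℕ} (hk : k < K) :
    (φ * ψ).1 k = ψ.1 k := by
  rw [mul_apply_eq, Finset.prod_eq_single (0, k)]
  · simp [φ.2.1]
  · rintro ⟨i, j⟩ h1 h2
    rw [Finset.HasAntidiagonal.mem_antidiagonal] at h1
    have hi : i ≠ 0 := by
      rintro rfl
      simp_all
    exact comp_eq_one_of_filtration hφ ψ (by omega) (by simp at h1; omega)
  · simp

theorem filtration_mul_apply_self (hφ : φ ∈ filtration K) (hK : 1 ≤ K) (ψ : EllisH) :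
    (φ * ψ).1 K = ψ.1 K * φ.1 K := by
  rw [mul_apply_eq, Finset.prod_eq_mul (0, K) (K, 0)]
  · simp [φ.2.1, ψ.2.1]
  · simp; omega
  · rintro ⟨i, j⟩ h1 ⟨h2, h3⟩
    rw [Finset.HasAntidiagonal.mem_antidiagonal] at h1
    simp only [ne_eq, Prod.mk.injEq, not_and] at h1 h2 h3
    exact comp_eq_one_of_filtration hφ ψ (by omega) (by omega)
  · simp
  · simp

theorem filtration_mul_apply_succ (hφ : φ ∈ filtration K) (hK : 1 ≤ K) (ψ : EllisH) :
    (φ * ψ).1 (K + 1) = ψ.1 (K + 1) * (φ.1 K).comp (ψ.1 1) * φ.1 (K + 1) := by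
  rw [mul_apply_eq, Finset.Nat.prod_antidiagonal_succ', Finset.prod_eq_mul (0, K) (K, 0)]
  · simp [φ.2.1, ψ.2.1, mul_comm]
  · simp; omega
  · rintro ⟨i, j⟩ h1 ⟨h2, h3⟩
    rw [Finset.HasAntidiagonal.mem_antidiagonal] at h1
    simp only [ne_eq, Prod.mk.injEq, not_and] at h1 h2 h3
    exact comp_eq_one_of_filtration hφ ψ (by omega) (by omega)
  · simp
  · simp

theorem mul_filtration_apply_of_lt (hφ : φ ∈ filtration K) (ψ : EllisH) {k : ℕ} (hk : k < K) :
    (ψ * φ).1 k = ψ.1 k := by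
  rw [mul_apply_eq, Finset.prod_eq_single (k, 0)]
  · simp [φ.2.1]
  · rintro ⟨i, j⟩ h1 h2
    rw [Finset.HasAntidiagonal.mem_antidiagonal] at h1
    have hj : j ≠ 0 := by
      rintro rfl
      simp_all
    simp only at h1
    rw [hφ j (by omega) (by omega), MonoidHom.comp_one]
  · simp

theorem mul_filtration_apply_self (hφ : φ ∈ filtration K) (hK : 1 ≤ K) (ψ : EllisH) :
    (ψ * φ).1 K = ψ.1 K * φ.1 K := by
  rw [mul_apply_eq, Finset.prod_eq_mul (K, 0) (0, K)]
  · simp [φ.2.1, ψ.2.1]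
  · simp; omega
  · rintro ⟨i, j⟩ h1 ⟨h2, h3⟩
    rw [Finset.HasAntidiagonal.mem_antidiagonal] at h1
    simp only [ne_eq, Prod.mk.injEq, not_and] at h1 h2 h3
    rw [hφ j (by omega) (by omega), MonoidHom.comp_one]
  · simp
  · simp

theorem mul_filtration_apply_succ (hφ : φ ∈ filtration K) (hK : 1 ≤ K) (ψ : EllisH) :
    (ψ * φ).1 (K + 1) = ψ.1 (K + 1) * (ψ.1 1).comp (φ.1 K) * φ.1 (K + 1) := by
  rw [mul_apply_eq, Finset.Nat.prod_antidiagonal_succ, Finset.prod_eq_mul (K, 0) (0, K)]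
  · simp only [φ.2.1, ψ.2.1, MonoidHom.comp_id, MonoidHom.id_comp, zero_add]
    exact mul_comm _ _
  · simp; omega
  · rintro ⟨i, j⟩ h1 ⟨h2, h3⟩
    rw [Finset.HasAntidiagonal.mem_antidiagonal] at h1
    simp only [ne_eq, Prod.mk.injEq, not_and] at h1 h2 h3
    rw [hφ j (by omega) (by omega), MonoidHom.comp_one]
  · simp
  · simp

theorem mem_filtration_of_mul_apply (c ψ : EllisH)
    (h : ∀ k < K, (c * ψ).1 k = ψ.1 k) : c ∈ filtration K := by
  intro j
  induction j using Nat.strong_induction_on with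
  | _ j ih =>
    intro hj hK
    have hc : c ∈ filtration j := fun i hi hij => ih i hij hi (hij.trans hK)
    have h1 := filtration_mul_apply_self hc hj ψ
    rw [h j hK] at h1
    exact left_eq_mul.1 h1

theorem filtration_one : filtration 1 = Set.univ :=
  Set.eq_univ_of_forall fun φ j h1 h2 => by omega

theorem mul_mem_filtration {ψ : EllisH} (hφ : φ ∈ filtration K) (hψ : ψ ∈ filtration K) :
    φ * ψ ∈ filtration K := fun j h1 h2 => by
  rw [filtration_mul_apply_of_lt hφ ψ h2, hψ j h1 h2]

theorem inv_mem_filtration (hφ : φ ∈ filtration K) : φ⁻¹ ∈ filtration K := fun j h1 h2 => by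
  rw [← filtration_mul_apply_of_lt hφ φ⁻¹ h2, mul_inv_cancel, coe_one]
  obtain ⟨i, rfl⟩ : ∃ i, j = i + 1 := ⟨j - 1, by omega⟩
  exact tilde_zero_succ i

theorem isClosed_filtration (K : ℕ) : IsClosed (filtration K) := by
  have h : filtration K = ⋂ (j : ℕ) (_ : 1 ≤ j) (_ : j < K), {φ : EllisH | φ.1 j = 1} := by
    ext φ
    simp [filtration]
  rw [h]
  exact isClosed_iInter fun j => isClosed_iInter fun _ => isClosed_iInter fun _ =>
    isClosed_eq ((continuous_apply j).comp continuous_subtype_val) continuous_const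

/-- The commutator of an element with a member of the filtration. -/
theorem commutator_mem_filtration (a : EllisH) (hφ : φ ∈ filtration K) (hK : 1 ≤ K) :
    a * φ * (φ * a)⁻¹ ∈ filtration (K + 1) := by
  refine mem_filtration_of_mul_apply _ (φ * a) fun k hk => ?_
  rw [inv_mul_cancel_right]
  rcases Nat.lt_succ_iff_lt_or_eq.1 hk with h | rfl
  · rw [mul_filtration_apply_of_lt hφ a h, filtration_mul_apply_of_lt hφ a h]
  · rw [mul_filtration_apply_self hφ hK, filtration_mul_apply_self hφ hK]

theorem commutator_apply (a : EllisH) (hφ : φ ∈ filtration K) (hK : 1 ≤ K) :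
    (a * φ * (φ * a)⁻¹).1 (K + 1) * (φ.1 K).comp (a.1 1) = (a.1 1).comp (φ.1 K) := by
  have h := filtration_mul_apply_self (commutator_mem_filtration a hφ hK) (by omega) (φ * a)
  rw [inv_mul_cancel_right, mul_filtration_apply_succ hφ hK, filtration_mul_apply_succ hφ hK] at h
  have h2 : a.1 (K + 1) * φ.1 (K + 1) * (a.1 1).comp (φ.1 K) =
      a.1 (K + 1) * φ.1 (K + 1) *
        ((a * φ * (φ * a)⁻¹).1 (K + 1) * (φ.1 K).comp (a.1 1)) := by
    rw [mul_right_comm, h]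
    ac_rfl
  exact (mul_left_cancel h2).symm

end Filtration

/-! ### Minimality of `(𝓗, T)` -/

theorem tildeH_mul (m n : ℤ) : tildeH m * tildeH n = tildeH (m + n) :=
  Subtype.ext (star_tilde_tilde m n)

theorem tildeH_zero : tildeH 0 = 1 := rfl

theorem mul_mem_closure_range_tildeH {a b : EllisH} (ha : a ∈ closure (Set.range tildeH))
    (hb : b ∈ closure (Set.range tildeH)) : a * b ∈ closure (Set.range tildeH) := by
  have h1 : ∀ n, tildeH n * b ∈ closure (Set.range tildeH) := fun n =>
    map_mem_closure (continuous_tildeH_mul n) hb (by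
      rintro _ ⟨m, rfl⟩
      exact ⟨n + m, (tildeH_mul n m).symm⟩)
  have h2 := map_mem_closure (EllisH.continuous_mul_right b) ha
    (t := closure (Set.range tildeH)) (by
      rintro _ ⟨n, rfl⟩
      exact h1 n)
  rwa [closure_closure] at h2

/-- The closure of the orbit of the identity. -/
def orbitClosure : Subgroup EllisH where
  carrier := closure (Set.range tildeH)
  one_mem' := subset_closure ⟨0, rfl⟩
  mul_mem' := mul_mem_closure_range_tildeH
  inv_mem' {a} ha := by
    obtain ⟨e, ⟨b, hb, rfl⟩, he⟩ := exists_idempotent_in_compact_subsemigroup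
      EllisH.continuous_mul_right ((fun b => b * a) '' closure (Set.range tildeH))
      ⟨_, a, ha, rfl⟩ (isClosed_closure.isCompact.image (EllisH.continuous_mul_right a)) (by
        rintro _ ⟨b, hb, rfl⟩ _ ⟨c, hc, rfl⟩
        exact ⟨b * a * c, mul_mem_closure_range_tildeH (mul_mem_closure_range_tildeH hb ha) hc, by simp only [mul_assoc]⟩)
    rw [mul_eq_left] at he
    rwa [← eq_inv_of_mul_eq_one_left he]

theorem isClosed_orbitClosure : IsClosed (orbitClosure : Set EllisH) := isClosed_closure

theorem tildeH_mem_orbitClosure (n : ℤ) : tildeH n ∈ orbitClosure := subset_closure ⟨n, rfl⟩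

/-- The `K`-th terms of those members of the orbit closure whose lower terms are trivial. -/
def leadingTerms (K : ℕ) (hK : 1 ≤ K) : Subgroup EndT where
  carrier := (fun φ : EllisH => φ.1 K) '' ((orbitClosure : Set EllisH) ∩ filtration K)
  one_mem' := by
    refine ⟨1, ⟨orbitClosure.one_mem, fun j h1 h2 => ?_⟩, ?_⟩
    · obtain ⟨i, rfl⟩ : ∃ i, j = i + 1 := ⟨j - 1, by omega⟩
      exact tilde_zero_succ i
    · obtain ⟨i, rfl⟩ : ∃ i, K = i + 1 := ⟨K - 1, by omega⟩
      exact tilde_zero_succ i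
  mul_mem' := by
    rintro _ _ ⟨φ, ⟨h1, h2⟩, rfl⟩ ⟨ψ, ⟨h3, h4⟩, rfl⟩
    exact ⟨φ * ψ, ⟨orbitClosure.mul_mem h1 h3, mul_mem_filtration h2 h4⟩,
      mul_filtration_apply_self h4 hK φ⟩
  inv_mem' := by
    rintro _ ⟨φ, ⟨h1, h2⟩, rfl⟩
    refine ⟨φ⁻¹, ⟨orbitClosure.inv_mem h1, inv_mem_filtration h2⟩, ?_⟩
    have h3 := filtration_mul_apply_self h2 hK φ⁻¹
    rw [mul_inv_cancel, coe_one] at h3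
    obtain ⟨i, rfl⟩ : ∃ i, K = i + 1 := ⟨K - 1, by omega⟩
    rw [tilde_zero_succ] at h3
    exact eq_inv_of_mul_eq_one_left h3.symm

theorem mem_leadingTerms {K : ℕ} {hK : 1 ≤ K} {χ : EndT} : χ ∈ leadingTerms K hK ↔
    ∃ φ ∈ orbitClosure, φ ∈ filtration K ∧ φ.1 K = χ := by
  constructor
  · rintro ⟨φ, ⟨h1, h2⟩, h3⟩
    exact ⟨φ, h1, h2, h3⟩
  · rintro ⟨φ, h1, h2, h3⟩
    exact ⟨φ, ⟨h1, h2⟩, h3⟩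

theorem isClosed_leadingTerms (K : ℕ) (hK : 1 ≤ K) : IsClosed (leadingTerms K hK : Set EndT) :=
  ((isClosed_orbitClosure.inter (isClosed_filtration K)).isCompact.image
    ((continuous_apply K).comp continuous_subtype_val)).isClosed

theorem leadingTerms_one : leadingTerms 1 le_rfl = ⊤ := by
  refine Subgroup.eq_top_iff' _ |>.2 fun χ =>
    mem_of_annihilator _ (isClosed_leadingTerms 1 le_rfl) χ fun x hx => ?_
  have h := hx (MonoidHom.id Circle) (mem_leadingTerms.2 ⟨tildeH 1, tildeH_mem_orbitClosure 1,
    by rw [filtration_one]; trivial, tilde_one_one⟩)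
  rw [MonoidHom.id_apply] at h
  rw [h, map_one]

theorem mem_leadingTerms_of_trivial (K : ℕ) (hK : 1 ≤ K) {χ : EndT} (hχ : ∀ y ∈ TQ, χ y = 1) :
    χ ∈ leadingTerms K hK := by
  induction K, hK using Nat.le_induction generalizing χ with
  | base => rw [leadingTerms_one]; trivial
  | succ K hK ih =>
    refine mem_of_annihilator _ (isClosed_leadingTerms _ _) χ fun x hx => ?_
    by_cases hxQ : x ∈ TQ
    · exact hχ x hxQ
    exfalso
    obtain ⟨β, hβ, hβx⟩ := exists_endT_eq hxQ negOne
    obtain ⟨α, hα, hαx⟩ := exists_endT_negOne hxQ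
    obtain ⟨b, hb, hbK, rfl⟩ := mem_leadingTerms.1 (ih hβ)
    obtain ⟨a, ha, -, rfl⟩ := mem_leadingTerms.1
      (show α ∈ leadingTerms 1 le_rfl by rw [leadingTerms_one]; trivial)
    have h1 := hx _ (mem_leadingTerms.2 ⟨_, orbitClosure.mul_mem (orbitClosure.mul_mem ha hb)
      (orbitClosure.inv_mem (orbitClosure.mul_mem hb ha)), commutator_mem_filtration a hbK hK,
      rfl⟩)
    have h2 := congrArg (fun f : EndT => f x) (commutator_apply a hbK hK)
    simp only [MonoidHom.mul_apply, MonoidHom.comp_apply, h1, hβx, hα, hαx, map_one] at h2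
    exact negOne_ne_one (h2.symm.trans (one_mul 1))

theorem exists_mem_orbitClosure_eq (φ : EllisH) (K : ℕ) :
    ∃ a ∈ orbitClosure, ∀ k < K, a.1 k = φ.1 k := by
  induction K with
  | zero => exact ⟨1, orbitClosure.one_mem, fun k hk => absurd hk (Nat.not_lt_zero k)⟩
  | succ K ih =>
    obtain ⟨a, ha, hak⟩ := ih
    rcases Nat.eq_zero_or_pos K with rfl | hK
    · refine ⟨a, ha, fun k hk => ?_⟩
      rw [Nat.lt_one_iff.1 hk, a.2.1, φ.2.1]
    have hc : φ * a⁻¹ ∈ filtration K := mem_filtration_of_mul_apply _ a fun k hk => by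
      rw [inv_mul_cancel_right, hak k hk]
    have hK1 := filtration_mul_apply_self hc hK a
    rw [inv_mul_cancel_right] at hK1
    have hlead : (φ * a⁻¹).1 K ∈ leadingTerms K hK := by
      rcases Nat.eq_or_lt_of_le hK with rfl | hK2
      · rw [leadingTerms_one]; trivial
      · refine mem_leadingTerms_of_trivial K hK fun y hy => ?_
        obtain ⟨i, rfl⟩ : ∃ i, K = i + 1 := ⟨K - 1, by omega⟩
        exact apply_eq_one_of_apply_one _ (fun y _ => by rw [hc 1 le_rfl hK2]; rfl) i hy
    obtain ⟨b, hb, hbK, hbc⟩ := mem_leadingTerms.1 hlead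
    refine ⟨b * a, orbitClosure.mul_mem hb ha, fun k hk => ?_⟩
    rcases Nat.lt_succ_iff_lt_or_eq.1 hk with h | rfl
    · rw [filtration_mul_apply_of_lt hbK a h, hak k h]
    · rw [filtration_mul_apply_self hbK hK, hbc, hK1]

theorem orbitClosure_eq_top : orbitClosure = ⊤ := by
  refine Subgroup.eq_top_iff' _ |>.2 fun φ => ?_
  choose a ha hak using exists_mem_orbitClosure_eq φ
  refine isClosed_orbitClosure.mem_of_tendsto (b := Filter.atTop) (f := a) ?_ (.of_forall ha)
  rw [tendsto_subtype_rng, tendsto_pi_nhds]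
  intro k
  refine tendsto_const_nhds.congr' ?_
  filter_upwards [Filter.eventually_gt_atTop k] with K hK
  exact (hak K k hK).symm

theorem dense_range_tildeH : DenseRange tildeH := fun φ => by
  have h : φ ∈ orbitClosure := by rw [orbitClosure_eq_top]; trivial
  exact h

theorem isMinimalSystem_T : IsMinimalSystem T := by
  intro Z hZ ⟨φ, hφ⟩ hinv
  have hmem : ∀ ψ, T ψ ∈ Z ↔ ψ ∈ Z := fun ψ => by
    conv_lhs => rw [← hinv]
    exact T.injective.mem_set_image
  have h1 : ∀ ψ, tildeH 1 * ψ ∈ Z ↔ ψ ∈ Z := fun ψ => by rw [← T_apply, hmem]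
  have h2 : ∀ n : ℤ, tildeH n * φ ∈ Z := fun n => by
    induction n using Int.induction_on with
    | zero => rwa [tildeH_zero, one_mul]
    | succ n ih => rwa [add_comm, ← tildeH_mul, mul_assoc, h1]
    | pred n ih =>
      rw [← h1, ← mul_assoc, tildeH_mul]
      convert ih using 3
      ring
  refine Set.eq_univ_of_forall fun ψ => ?_
  have h3 := map_mem_closure (EllisH.continuous_mul_right φ) (dense_range_tildeH (ψ * φ⁻¹))
    (t := Z) (by
      rintro _ ⟨n, rfl⟩
      exact h2 n)
  rwa [inv_mul_cancel_right, hZ.closure_eq] at h3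

/-! ### Quasi-discrete spectrum of `(𝓗, T)` -/

/-- The function `φ ↦ φ_k (x)` on `𝓗`. -/
def coordinate (k : ℕ) (x : Circle) : C(EllisH, Circle) := ⟨fun φ => φ.1 k x, continuous_eval k x⟩

theorem coordinate_mem (k : ℕ) (x : Circle) : coordinate k x ∈ quasiEigenfunctions T k := by
  induction k with
  | zero => exact ⟨x, by ext φ; simp [coordinate, φ.2.1]⟩
  | succ k ih => exact ⟨_, ih, fun φ => rfl⟩

theorem hasQuasiDiscreteSpectrum_T : HasQuasiDiscreteSpectrum T := by
  refine hasQuasiDiscreteSpectrum_of_separates T fun φ ψ hne => ?_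
  by_contra h
  push Not at h
  exact hne (EllisH.ext fun k x => h k _ (coordinate_mem k x))

/-! ### Cosets of `𝓖` -/

/-- The element of `𝓗` with `χ` at the index `j + 1`, and trivial other positive terms. -/
def single (j : ℕ) (χ : EndT) (hχ : ∀ y ∈ TQ, χ y = 1) : EllisH :=
  ⟨fun k => Nat.casesOn k (MonoidHom.id Circle) fun i => if i = j then χ else 1,
    mem_ellisSet_of_trivial rfl fun k y hy => by
      change (if k = j then χ else 1 : EndT) y = 1
      split_ifs
      exacts [hχ y hy, rfl]⟩

theorem single_apply_self (j : ℕ) (χ : EndT) (hχ : ∀ y ∈ TQ, χ y = 1) :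
    (single j χ hχ).1 (j + 1) = χ := if_pos rfl

theorem single_apply_of_ne {i j : ℕ} (h : i ≠ j) (χ : EndT) (hχ : ∀ y ∈ TQ, χ y = 1) :
    (single j χ hχ).1 (i + 1) = 1 := if_neg h

/-- The second term of `φ` at `x`, twisted by the first one if the latter moves `-1`. -/
def twisted (x : Circle) (φ : EllisH) : Circle :=
  open Classical in if φ.1 1 negOne = 1 then φ.1 2 x else φ.1 2 x * (φ.1 1 x)⁻¹

theorem apply_negOne (φ : EllisH) : φ.1 1 negOne = 1 ∨ φ.1 1 negOne = negOne :=
  eq_one_or_negOne (by rw [← map_mul, negOne_mul_self, map_one])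

theorem twisted_of_apply_negOne {x : Circle} {φ : EllisH} (h : φ.1 1 negOne = 1) :
    twisted x φ = φ.1 2 x := if_pos h

theorem twisted_of_apply_negOne' {x : Circle} {φ : EllisH} (h : φ.1 1 negOne = negOne) :
    twisted x φ = φ.1 2 x * (φ.1 1 x)⁻¹ := if_neg (by rw [h]; exact negOne_ne_one)

open Classical in
theorem continuous_twisted (x : Circle) : Continuous (twisted x) := by
  have hclopen : IsClopen {φ : EllisH | φ.1 1 negOne = 1} := by
    refine ⟨isClosed_eq (continuous_eval 1 negOne) continuous_const, ?_⟩
    have h : {φ : EllisH | φ.1 1 negOne = 1} = {φ : EllisH | φ.1 1 negOne = negOne}ᶜ := by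
      ext φ
      simp only [Set.mem_ofPred_eq, Set.mem_compl_iff]
      rcases apply_negOne φ with h | h
      · simp [h, negOne_ne_one.symm]
      · simp [h, negOne_ne_one]
    rw [h]
    exact (isClosed_eq (continuous_eval 1 negOne) continuous_const).isOpen_compl
  refine Continuous.if (fun φ hφ => ?_) (continuous_eval 2 x)
    ((continuous_eval 2 x).mul (continuous_eval 1 x).inv)
  rw [hclopen.frontier_eq] at hφ
  exact hφ.elim

theorem twisted_mul (x : Circle) (φ : EllisH) {γ : EllisH} (h1 : γ.1 1 (x ^ 2) = 1)
    (h2 : ∀ y ∈ TQ, γ.1 1 y = 1) : twisted x (φ * γ) = twisted x φ * γ.1 2 x := by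
  have hneg : (φ * γ).1 1 negOne = φ.1 1 negOne := by
    rw [mul_apply_one, h2 _ negOne_mem_TQ, mul_one]
  have hγ : γ.1 1 x = 1 ∨ γ.1 1 x = negOne :=
    eq_one_or_negOne (by rw [← map_mul, ← pow_two, h1])
  rcases apply_negOne φ with h | h
  · rw [twisted_of_apply_negOne (hneg.trans h), twisted_of_apply_negOne h, mul_apply_two]
    rcases hγ with h3 | h3 <;> simp [h3, h]
  · rw [twisted_of_apply_negOne' (hneg.trans h), twisted_of_apply_negOne' h, mul_apply_two,
      mul_apply_one]
    rcases hγ with h3 | h3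
    · simp [h3, mul_right_comm]
    · rw [h3, h, mul_inv]
      calc φ.1 2 x * negOne * γ.1 2 x * ((φ.1 1 x)⁻¹ * negOne⁻¹)
          = φ.1 2 x * (φ.1 1 x)⁻¹ * γ.1 2 x * (negOne * negOne⁻¹) := by ac_rfl
        _ = _ := by rw [mul_inv_cancel, mul_one]

/-- A complete invariant of the left cosets of `𝓖`. -/
def cosetInvariant (x : Circle) (φ : EllisH) : Circle × (TQ → Circle) × Circle :=
  (φ.1 1 (x ^ 2), fun y => φ.1 1 y, twisted x φ)

theorem continuous_cosetInvariant (x : Circle) : Continuous (cosetInvariant x) :=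
  (continuous_eval 1 _).prodMk
    ((continuous_pi fun y : TQ => continuous_eval 1 (y : Circle)).prodMk (continuous_twisted x))

theorem mem_exampleG {x : Circle} {φ : EllisH} : φ ∈ exampleG x ↔
    (φ.1 1 (x ^ 2) = 1 ∧ ∀ y ∈ TQ, φ.1 1 y = 1) ∧ φ.1 2 x = 1 := Iff.rfl

theorem cosetInvariant_mul_eq_iff (x : Circle) (φ γ : EllisH) :
    cosetInvariant x (φ * γ) = cosetInvariant x φ ↔ γ ∈ exampleG x := by
  have key : ∀ y, (φ * γ).1 1 y = φ.1 1 y ↔ γ.1 1 y = 1 := fun y => by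
    rw [mul_apply_one, mul_eq_left]
  rw [cosetInvariant, cosetInvariant, Prod.mk.injEq, Prod.mk.injEq, key, mem_exampleG, and_assoc,
    funext_iff]
  simp only [key, Subtype.forall]
  refine and_congr_right fun h1 => and_congr_right fun h2 => ?_
  rw [twisted_mul x φ h1 h2, mul_eq_left]

theorem cosetInvariant_eq_iff (x : Circle) (φ ψ : EllisH) :
    cosetInvariant x φ = cosetInvariant x ψ ↔
      (φ : EllisH ⧸ exampleG x) = (ψ : EllisH ⧸ exampleG x) := by
  rw [QuotientGroup.eq, ← cosetInvariant_mul_eq_iff x φ, mul_inv_cancel_left, eq_comm]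

theorem isClosed_exampleG (x : Circle) : IsClosed (exampleG x : Set EllisH) := by
  have h : (exampleG x : Set EllisH) = cosetInvariant x ⁻¹' {cosetInvariant x 1} := by
    ext φ
    rw [Set.mem_preimage, Set.mem_singleton_iff, SetLike.mem_coe,
      ← cosetInvariant_mul_eq_iff x 1 φ, one_mul]
  rw [h]
  exact isClosed_singleton.preimage (continuous_cosetInvariant x)

instance (x : Circle) : T2Space (EllisH ⧸ exampleG x) := by
  refine T2Space.of_injective_continuous (f := Quotient.lift (cosetInvariant x) fun φ ψ h =>
    (cosetInvariant_eq_iff x φ ψ).2 (Quotient.sound h)) ?_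
    ((continuous_cosetInvariant x).quotient_lift _)
  intro p q
  induction p using QuotientGroup.induction_on with
  | H φ =>
    induction q using QuotientGroup.induction_on with
    | H ψ => exact (cosetInvariant_eq_iff x φ ψ).1

theorem isHomomorphism_mk (G : Subgroup EllisH) :
    IsHomomorphism T (quotientT G) (fun φ => (φ : EllisH ⧸ G)) :=
  ⟨continuous_quot_mk, QuotientGroup.mk_surjective, fun _ => rfl⟩

/-! ### The enveloping semigroup of a quotient of `𝓗` -/

section Quotient

variable (G : Subgroup EllisH)

theorem quotientT_apply (q : EllisH ⧸ G) : quotientT G q = tildeH 1 • q := by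
  induction q using QuotientGroup.induction_on with
  | H φ => exact congrArg (QuotientGroup.mk (s := G)) (T_apply φ)

theorem quotientT_zpow_apply (n : ℤ) (q : EllisH ⧸ G) :
    ((quotientT G) ^ n : (EllisH ⧸ G) ≃ₜ (EllisH ⧸ G)) q = tildeH n • q := by
  induction n using Int.induction_on generalizing q with
  | zero => rw [tildeH_zero, one_smul]; rfl
  | succ n ih =>
    rw [zpow_add_one, Homeomorph.mul_apply, ih, quotientT_apply, smul_smul, tildeH_mul]
  | pred n ih =>
    have h : (quotientT G)⁻¹ q = tildeH (-1) • q := by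
      rw [Homeomorph.inv_apply, Homeomorph.symm_apply_eq, quotientT_apply, smul_smul, tildeH_mul]
      exact (one_smul _ q).symm
    rw [zpow_sub_one, Homeomorph.mul_apply, ih, h, smul_smul, tildeH_mul, sub_eq_add_neg]

theorem continuous_smul_quotient :
    Continuous fun (ψ : EllisH) (q : EllisH ⧸ G) => ψ • q := by
  refine continuous_pi fun q => ?_
  induction q using QuotientGroup.induction_on with
  | H φ => exact continuous_quot_mk.comp (EllisH.continuous_mul_right φ)

theorem envelopingSemigroup_quotientT [T2Space (EllisH ⧸ G)] :
    envelopingSemigroup (quotientT G) = Set.range fun (ψ : EllisH) (q : EllisH ⧸ G) => ψ • q := by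
  have hT : (fun n : ℤ => ((quotientT G ^ n : (EllisH ⧸ G) ≃ₜ (EllisH ⧸ G)) : _ → _)) =
      (fun (ψ : EllisH) (q : EllisH ⧸ G) => ψ • q) ∘ tildeH :=
    funext fun n => funext fun q => quotientT_zpow_apply G n q
  rw [envelopingSemigroup, hT]
  refine Set.Subset.antisymm ?_ ?_
  · exact closure_minimal (Set.range_comp_subset_range _ _)
      (isCompact_range (continuous_smul_quotient G)).isClosed
  · rw [Set.range_comp]
    rintro _ ⟨ψ, rfl⟩
    exact image_closure_subset_closure_image (continuous_smul_quotient G)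
      ⟨ψ, dense_range_tildeH ψ, rfl⟩

theorem isDistal_quotientT [T2Space (EllisH ⧸ G)] : IsDistal (quotientT G) := by
  intro a ha
  rw [envelopingSemigroup_quotientT] at ha
  obtain ⟨ψ, rfl⟩ := ha
  exact MulAction.injective ψ

theorem smul_mem_envelopingSemigroup [T2Space (EllisH ⧸ G)] (ψ : EllisH) :
    (fun q : EllisH ⧸ G => ψ • q) ∈ envelopingSemigroup (quotientT G) := by
  rw [envelopingSemigroup_quotientT]
  exact ⟨ψ, rfl⟩

/-- The action of `𝓗` on a quotient, as a map onto the enveloping semigroup. -/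
def toEnveloping [T2Space (EllisH ⧸ G)] :
    C(EllisH, envelopingSemigroup (quotientT G)) where
  toFun ψ := ⟨fun q => ψ • q, smul_mem_envelopingSemigroup G ψ⟩
  continuous_toFun := (continuous_smul_quotient G).subtype_mk (smul_mem_envelopingSemigroup G)

variable [T2Space (EllisH ⧸ G)]

theorem toEnveloping_surjective : Function.Surjective (toEnveloping G) := by
  rintro ⟨a, ha⟩
  have h := ha
  rw [envelopingSemigroup_quotientT] at h
  obtain ⟨ψ, rfl⟩ := h
  exact ⟨ψ, rfl⟩

theorem isQuotientMap_toEnveloping : Topology.IsQuotientMap (toEnveloping G) :=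
  (toEnveloping G).continuous.isClosedMap.isQuotientMap (toEnveloping G).continuous
    (toEnveloping_surjective G)

theorem leftTranslation_toEnveloping (ψ : EllisH) :
    leftTranslation (quotientT G) (toEnveloping G ψ) = toEnveloping G (T ψ) := by
  refine Subtype.ext (funext fun q => ?_)
  change quotientT G (ψ • q) = T ψ • q
  rw [quotientT_apply, T_apply, mul_smul]

end Quotient

variable {x : Circle}

theorem toEnveloping_eq_iff (hx : x ∉ TQ) (φ ψ : EllisH) :
    toEnveloping (exampleG x) φ = toEnveloping (exampleG x) ψ ↔
      (∀ y, φ.1 1 y = ψ.1 1 y) ∧ φ.1 2 x = ψ.1 2 x := by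
  constructor
  · intro h
    have hκ : ∀ η : EllisH, cosetInvariant x (φ⁻¹ * ψ * η) = cosetInvariant x η := fun η => by
      have h1 : φ • (η : EllisH ⧸ exampleG x) = ψ • (η : EllisH ⧸ exampleG x) :=
        congrFun (congrArg Subtype.val h) η
      refine (cosetInvariant_eq_iff x _ _).2 ?_
      change ((φ⁻¹ * ψ) • η : EllisH ⧸ exampleG x) = _
      rw [mul_smul, ← h1, inv_smul_smul]
    obtain ⟨κ, rfl⟩ : ∃ κ, ψ = φ * κ := ⟨φ⁻¹ * ψ, (mul_inv_cancel_left φ ψ).symm⟩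
    simp only [inv_mul_cancel_left] at hκ
    have hκG : κ ∈ exampleG x := by
      rw [← cosetInvariant_mul_eq_iff x 1, one_mul, ← hκ 1, mul_one]
    obtain ⟨⟨-, h2⟩, h3⟩ := mem_exampleG.1 hκG
    have h1 : ∀ y, κ.1 1 y = 1 := fun y => by
      obtain ⟨χ, hχ, rfl⟩ := exists_endT_eq hx y
      have h4 := congrArg (fun c => c.2.2) (hκ (single 0 χ hχ))
      have h5 : (single 0 χ hχ).1 1 negOne = 1 := hχ _ negOne_mem_TQ
      have h6 : (single 0 χ hχ).1 2 = 1 := single_apply_of_ne one_ne_zero χ hχ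
      simp only [cosetInvariant] at h4
      rw [twisted_of_apply_negOne h5, twisted_of_apply_negOne
        (by rw [mul_apply_one, h5, h2 _ negOne_mem_TQ, one_mul]), mul_apply_two, h6, h3] at h4
      have h7 : (single 0 χ hχ).1 1 = χ := single_apply_self 0 χ hχ
      simpa [h7] using h4
    refine ⟨fun y => ?_, ?_⟩
    · rw [mul_apply_one, h1, mul_one]
    · rw [mul_apply_two, h1, h3, map_one, mul_one, mul_one]
  · rintro ⟨h1, h2⟩
    refine Subtype.ext (funext fun q => ?_)
    induction q using QuotientGroup.induction_on with
    | H η =>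
      refine (cosetInvariant_eq_iff x (φ * η) (ψ * η)).1 ?_
      have h3 : (φ * η).1 1 = (ψ * η).1 1 := by
        ext1 y
        rw [mul_apply_one, mul_apply_one, h1]
      have h4 : (φ * η).1 2 x = (ψ * η).1 2 x := by
        rw [mul_apply_two, mul_apply_two, h1, h2]
      rw [cosetInvariant, cosetInvariant, twisted, twisted, h3, h4]

theorem hasQuasiDiscreteSpectrum_leftTranslation (hx : x ∉ TQ) :
    HasQuasiDiscreteSpectrum (leftTranslation (quotientT (exampleG x))) := by
  have hquot := isQuotientMap_toEnveloping (exampleG x)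
  have : CompactSpace (envelopingSemigroup (quotientT (exampleG x))) :=
    isCompact_iff_compactSpace.1 isClosed_closure.isCompact
  have hex : ∀ k y, (∀ φ ψ, toEnveloping (exampleG x) φ = toEnveloping (exampleG x) ψ →
      φ.1 k y = ψ.1 k y) → ∃ f : C(envelopingSemigroup (quotientT (exampleG x)), Circle),
        ∀ φ, f (toEnveloping _ φ) = φ.1 k y := fun k y h =>
    ⟨hquot.lift (coordinate k y) fun φ ψ => h φ ψ, fun φ =>
      DFunLike.congr_fun (hquot.lift_comp (coordinate k y) fun φ ψ => h φ ψ) φ⟩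
  choose f1 hf1 using fun y => hex 1 y fun φ ψ h => ((toEnveloping_eq_iff hx φ ψ).1 h).1 y
  obtain ⟨f2, hf2⟩ := hex 2 x fun φ ψ h => ((toEnveloping_eq_iff hx φ ψ).1 h).2
  have h1 : ∀ y, f1 y ∈ quasiEigenfunctions (leftTranslation (quotientT (exampleG x))) 1 := by
    refine fun y => ⟨_, ⟨y, rfl⟩, fun p => ?_⟩
    obtain ⟨φ, rfl⟩ := toEnveloping_surjective _ p
    rw [leftTranslation_toEnveloping, hf1, hf1, T_apply, mul_apply_one]
    congr 1
    exact DFunLike.congr_fun tilde_one_one y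
  have h2 : f2 ∈ quasiEigenfunctions (leftTranslation (quotientT (exampleG x))) 2 := by
    refine ⟨_, h1 x, fun p => ?_⟩
    obtain ⟨φ, rfl⟩ := toEnveloping_surjective _ p
    rw [leftTranslation_toEnveloping, hf1, hf2, hf2]
    rfl
  refine hasQuasiDiscreteSpectrum_of_separates _ fun p q hne => ?_
  obtain ⟨φ, rfl⟩ := toEnveloping_surjective _ p
  obtain ⟨ψ, rfl⟩ := toEnveloping_surjective _ q
  by_contra h
  push Not at h
  refine hne ((toEnveloping_eq_iff hx φ ψ).2 ⟨fun y => ?_, ?_⟩)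
  · rw [← hf1, ← hf1]
    exact h 1 _ (h1 y)
  · rw [← hf2, ← hf2]
    exact h 2 _ h2

/-! ### Degrees of loops in the circle -/

theorem exists_continuous_lift {f : ℝ → Circle} (hf : Continuous f) :
    ∃ θ : ℝ → ℝ, Continuous θ ∧ ∀ t, Circle.exp (θ t) = f t := by
  obtain ⟨e, he⟩ := Circle.exp_surjective (f 0)
  obtain ⟨F, ⟨-, hF⟩, -⟩ :=
    Circle.isCoveringMap_exp.existsUnique_continuousMap_lifts ⟨f, hf⟩ 0 e he
  exact ⟨F, F.continuous, fun t => congrFun hF t⟩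

theorem eq_of_exp_eq_one {u : ℝ → ℝ} (hu : Continuous u) (h : ∀ t, Circle.exp (u t) = 1)
    (s t : ℝ) : u s = u t := by
  choose k hk using fun t => Circle.exp_eq_one.1 (h t)
  have hk' : ∀ t, (k t : ℝ) = u t / (2 * Real.pi) := fun t => by
    rw [hk]; field_simp
  have hc : Continuous k := by
    rw [Int.isClosedEmbedding_coe_real.isEmbedding.continuous_iff]
    exact (hu.div_const _).congr fun t => (hk' t).symm
  rw [hk, hk, PreconnectedSpace.constant inferInstance hc (x := s) (y := t)]

/-- The function `f` of period `1` with values in the circle has degree `d`. -/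
def HasDegree (f : ℝ → Circle) (d : ℤ) : Prop :=
  ∃ θ : ℝ → ℝ, Continuous θ ∧ (∀ t, Circle.exp (θ t) = f t) ∧
    ∀ t, θ (t + 1) = θ t + d * (2 * Real.pi)

theorem exists_hasDegree {f : ℝ → Circle} (hf : Continuous f) (h : ∀ t, f (t + 1) = f t) :
    ∃ d, HasDegree f d := by
  obtain ⟨θ, hθ, hexp⟩ := exists_continuous_lift hf
  have h1 : ∀ t, Circle.exp (θ (t + 1) - θ t) = 1 := fun t => by
    rw [Circle.exp_sub, hexp, hexp, h, div_self']
  obtain ⟨d, hd⟩ := Circle.exp_eq_one.1 (h1 0)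
  refine ⟨d, θ, hθ, hexp, fun t => ?_⟩
  rw [← hd, eq_of_exp_eq_one (by fun_prop) h1 0 t]
  ring

theorem HasDegree.unique {f : ℝ → Circle} {d e : ℤ} (hd : HasDegree f d) (he : HasDegree f e) :
    d = e := by
  obtain ⟨θ, hθ, hexp, hd⟩ := hd
  obtain ⟨η, hη, hexp', he⟩ := he
  have h := eq_of_exp_eq_one (hθ.sub hη)
    (fun t => by rw [Pi.sub_apply, Circle.exp_sub, hexp, hexp', div_self']) (0 + 1) 0
  simp only [Pi.sub_apply, hd, he] at h
  have h2 : (d : ℝ) * (2 * Real.pi) = e * (2 * Real.pi) := by linarith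
  exact_mod_cast mul_right_cancel₀ (by positivity) h2

theorem HasDegree.mul {f g : ℝ → Circle} {d e : ℤ} (hf : HasDegree f d) (hg : HasDegree g e) :
    HasDegree (fun t => f t * g t) (d + e) := by
  obtain ⟨θ, hθ, hexp, hd⟩ := hf
  obtain ⟨η, hη, hexp', he⟩ := hg
  refine ⟨fun t => θ t + η t, hθ.add hη, fun t => by rw [Circle.exp_add, hexp, hexp'], fun t => ?_⟩
  simp only [hd, he]
  push_cast
  ring

theorem HasDegree.inv {f : ℝ → Circle} {d : ℤ} (hf : HasDegree f d) :
    HasDegree (fun t => (f t)⁻¹) (-d) := by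
  obtain ⟨θ, hθ, hexp, hd⟩ := hf
  refine ⟨fun t => -θ t, hθ.neg, fun t => by rw [Circle.exp_neg, hexp], fun t => ?_⟩
  simp only [hd]
  push_cast
  ring

theorem hasDegree_const (c : Circle) : HasDegree (fun _ => c) 0 := by
  obtain ⟨θ, rfl⟩ := Circle.exp_surjective c
  exact ⟨fun _ => θ, continuous_const, fun _ => rfl, fun t => by simp⟩

theorem hasDegree_exp (d : ℤ) : HasDegree (fun t => Circle.exp (2 * Real.pi * (d * t))) d :=
  ⟨fun t => 2 * Real.pi * (d * t), by fun_prop, fun _ => rfl, fun t => by ring⟩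

theorem HasDegree.abs_le {f : ℝ → Circle} {d : ℤ} (hf : HasDegree f d) {N : ℕ} (hN : 0 < N)
    (h : ∀ s t : ℝ, |t - s| ≤ 1 / N → f t ≠ f s * negOne) : |d| ≤ N := by
  obtain ⟨θ, hθ, hexp, hd⟩ := hf
  have hstep : ∀ s, |θ (s + 1 / N) - θ s| ≤ Real.pi := fun s => by
    by_contra hlt
    push Not at hlt
    have hc : ContinuousOn (fun r => |θ (s + r) - θ s|) (Set.Icc 0 (1 / N)) := by fun_prop
    obtain ⟨r, hr, hrπ⟩ := intermediate_value_Icc (by positivity) hc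
      (show Real.pi ∈ Set.Icc _ _ from ⟨by simp [Real.pi_pos.le], hlt.le⟩)
    refine h s (s + r) (by rw [add_sub_cancel_left, abs_of_nonneg hr.1]; exact hr.2) ?_
    have h1 : θ (s + r) = θ s + (θ (s + r) - θ s) := by ring
    rw [← hexp, ← hexp, h1, Circle.exp_add]
    congr 1
    rcases eq_or_eq_neg_of_abs_eq hrπ with h2 | h2
    · rw [h2, negOne]
    · rw [h2, Circle.exp_neg]
      exact inv_eq_of_mul_eq_one_left negOne_mul_self
  have hsum : ∀ k : ℕ, |θ (k / N) - θ 0| ≤ k * Real.pi := fun k => by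
    induction k with
    | zero => simp
    | succ k ih =>
      have h1 := hstep (k / N)
      have h2 : ((k + 1 : ℕ) : ℝ) / N = k / N + 1 / N := by push_cast; ring
      rw [h2]
      have h3 := abs_sub_le (θ (k / N + 1 / N)) (θ (k / N)) (θ 0)
      push_cast
      linarith
  have h1 := hsum N
  have hN' : (N : ℝ) ≠ 0 := by positivity
  rw [div_self hN', ← zero_add (1 : ℝ), hd, add_sub_cancel_left, abs_mul,
    abs_of_pos (by positivity : 0 < 2 * Real.pi)] at h1
  have h2 : |(d : ℝ)| * 2 ≤ N := by
    refine le_of_mul_le_mul_right ?_ Real.pi_pos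
    linarith
  have h3 : |(d : ℝ)| ≤ N := by linarith [abs_nonneg (d : ℝ)]
  exact_mod_cast h3

theorem exists_exponent {χ : ℝ → Circle} (hc : Continuous χ) (hmul : ∀ s t, χ (s + t) = χ s * χ t)
    (h1 : χ 1 = 1) : ∃ E : ℤ, ∀ s, χ s = Circle.exp (2 * Real.pi * (E * s)) := by
  obtain ⟨E, θ, hθ, hexp, hE⟩ := exists_hasDegree hc fun t => by rw [hmul, h1, mul_one]
  have h0 : χ 0 = 1 := by simpa using hmul 0 0
  have hadd : ∀ s t, θ (s + t) - θ 0 = θ s - θ 0 + (θ t - θ 0) := fun s t => by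
    have h := eq_of_exp_eq_one (u := fun t => θ (s + t) - θ s - θ t) (by fun_prop)
      (fun t => by
        rw [Circle.exp_sub, Circle.exp_sub, hexp, hexp, hexp, hmul, mul_div_cancel_left, div_self'])
      t 0
    simp only [add_zero] at h
    linarith
  let Θ : ℝ →+ ℝ := AddMonoidHom.mk' (fun t => θ t - θ 0) hadd
  refine ⟨E, fun s => ?_⟩
  have hlin := map_real_smul Θ (show Continuous fun t => θ t - θ 0 by fun_prop) s 1
  have hs : θ s - θ 0 = s * (θ 1 - θ 0) := by simpa [Θ] using hlin
  have hE0 := hE 0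
  rw [zero_add] at hE0
  have h3 : Circle.exp (θ s - θ 0) = χ s := by rw [Circle.exp_sub, hexp, hexp, h0, div_one]
  rw [← h3, hs, hE0]
  congr 1
  ring

/-! ### Integer sequences with vanishing iterated differences -/

/-- The `m`-th iterated differences of the sequence vanish. -/
def DifferencesVanish : ℕ → (ℕ → ℤ) → Prop
  | 0, D => ∀ n, D n = 0
  | m + 1, D => DifferencesVanish m fun n => D (n + 1) - D n

theorem DifferencesVanish.difference {m : ℕ} {D : ℕ → ℤ} (h : DifferencesVanish m D) :
    DifferencesVanish m fun n => D (n + 1) - D n := by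
  induction m generalizing D with
  | zero => exact fun n => by simp [h _]
  | succ m ih => exact ih h

theorem eq_zero_of_linear_bounded {a b C : ℤ} (h : ∀ n : ℕ, |a + n * b| ≤ C) : b = 0 := by
  by_contra hb
  have h0 := h 0
  have h1 := h (2 * C.toNat + 1)
  have hC : 0 ≤ C := (abs_nonneg _).trans h0
  have h2 : 1 ≤ |b| := Int.one_le_abs hb
  simp only [Nat.cast_zero, zero_mul, add_zero] at h0
  push_cast at h1
  rw [Int.toNat_of_nonneg hC] at h1
  have h3 : |(2 * C + 1) * b| ≤ |a + (2 * C + 1) * b| + |a| := by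
    have := abs_sub (a + (2 * C + 1) * b) a
    rwa [add_sub_cancel_left] at this
  rw [abs_mul, abs_of_nonneg (by omega : 0 ≤ 2 * C + 1)] at h3
  nlinarith

theorem DifferencesVanish.eq_of_bounded {m : ℕ} {D : ℕ → ℤ} (h : DifferencesVanish m D) {C : ℤ}
    (hC : ∀ n, |D n| ≤ C) (n : ℕ) : D n = D 0 := by
  induction m generalizing D C n with
  | zero => rw [h, h]
  | succ m ih =>
    have h1 := ih h (C := C + C) fun n =>
      (abs_sub _ _).trans (add_le_add (hC _) (hC _))
    have h2 : ∀ n : ℕ, D n = D 0 + n * (D 1 - D 0) := fun n => by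
      induction n with
      | zero => simp
      | succ n ihn =>
        have h3 := h1 n
        simp only [zero_add] at h3
        push_cast
        linarith
    have h3 := eq_zero_of_linear_bounded fun n => by rw [← h2]; exact hC n
    rw [h2, h3, mul_zero, add_zero]

theorem DifferencesVanish.even_of_bounded {m : ℕ} {D : ℕ → ℤ} (h : DifferencesVanish m D)
    {E C : ℤ} (hC : ∀ n : ℕ, |2 * D n - E * n| ≤ C) : Even E := by
  have h1 := h.difference.eq_of_bounded (C := C + |E|) fun n => by
    have h2 := hC n
    have h3 := hC (n + 1)
    push_cast at h3
    rw [abs_le] at h2 h3 ⊢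
    have h4 := le_abs_self E
    have h5 := neg_abs_le E
    constructor <;> nlinarith
  have h2 : ∀ n : ℕ, D n = D 0 + n * (D 1 - D 0) := fun n => by
    induction n with
    | zero => simp
    | succ n ihn =>
      have h3 := h1 n
      simp only [zero_add] at h3
      push_cast
      linarith
  have h3 := eq_zero_of_linear_bounded (a := 2 * D 0) (b := 2 * (D 1 - D 0) - E) (C := C)
    fun n => by
      refine le_of_eq_of_le ?_ (hC n)
      rw [h2 n]
      congr 1
      ring
  exact ⟨D 1 - D 0, by linarith⟩

theorem differencesVanish_degree {X : Type*} [TopologicalSpace X] {s : X ≃ₜ X} {P : ℕ → ℝ → X}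
    (hP : ∀ n t, s (P n t) = P (n + 1) t) {m : ℕ} {g : C(X, Circle)}
    (hg : g ∈ quasiEigenfunctions s m) {D : ℕ → ℤ}
    (hD : ∀ n, HasDegree (fun t => g (P n t)) (D n)) : DifferencesVanish m D := by
  induction m generalizing g D with
  | zero =>
    obtain ⟨c, rfl⟩ := hg
    exact fun n => (hD n).unique (hasDegree_const c)
  | succ m ih =>
    obtain ⟨f, hf, hfg⟩ := hg
    refine ih hf fun n => ?_
    have h := (hD (n + 1)).mul (hD n).inv
    rw [← sub_eq_add_neg] at h
    convert h using 2 with t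
    rw [← hP, hfg, mul_inv_cancel_right]

/-! ### The quotient by `𝓖` has no quasi-discrete spectrum -/

theorem continuous_circle_coe : Continuous fun z : Circle => (z : ℂ) := by fun_prop

/-- A family of endomorphisms that moves the point `x` along the circle and fixes the rational
points. -/
structure OneParameter (x : Circle) where
  /-- The endomorphism at the time `t`. -/
  toEnd : ℝ → EndT
  apply_rational : ∀ t, ∀ y ∈ TQ, toEnd t y = 1
  continuous_apply : ∀ y, Continuous fun t => toEnd t y
  apply_self : ∀ t, toEnd t x = Circle.exp (2 * Real.pi * t)

theorem nonempty_oneParameter {x : Circle} (hx : x ∉ TQ) : Nonempty (OneParameter x) := by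
  obtain ⟨f, hf, hQ, hfx⟩ := exists_functional hx 1
  refine ⟨fun t => MonoidHom.mk' (fun y => Circle.exp (2 * Real.pi * t * f y))
    fun y z => by rw [hf, mul_add, Circle.exp_add], fun t y hy => ?_, fun y => ?_, fun t => ?_⟩
  · simp [hQ y hy]
  · simp only [MonoidHom.mk'_apply]
    fun_prop
  · simp [hfx]

/-- The curve in `𝓗` with the one-parameter family at the index `j + 1`. -/
def OneParameter.curve {x : Circle} (ℓ : OneParameter x) (j : ℕ) (t : ℝ) : EllisH :=
  single j (ℓ.toEnd t) (ℓ.apply_rational t)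

section Curves

variable {x : Circle}

theorem OneParameter.continuous_curve (ℓ : OneParameter x) (j : ℕ) :
    Continuous (ℓ.curve j) := by
  refine EllisH.continuous_of_eval fun k y => ?_
  cases k with
  | zero => exact continuous_const
  | succ k =>
    by_cases h : k = j
    · subst h
      simpa only [OneParameter.curve, single_apply_self] using ℓ.continuous_apply y
    · simp only [OneParameter.curve, single_apply_of_ne h]
      exact continuous_const

theorem cosetInvariant_mul_single_one (φ : EllisH) (χ : EndT) (hχ : ∀ y ∈ TQ, χ y = 1) :
    cosetInvariant x (φ * single 1 χ hχ) =
      (φ.1 1 (x ^ 2), fun y : TQ => φ.1 1 y, twisted x φ * χ x) := by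
  have h1 : (single 1 χ hχ).1 1 = 1 := single_apply_of_ne zero_ne_one χ hχ
  have h2 : (single 1 χ hχ).1 2 = χ := single_apply_self 1 χ hχ
  rw [cosetInvariant, twisted_mul x φ (by rw [h1]; rfl) (fun y _ => by rw [h1]; rfl), h2]
  simp only [mul_apply_one, h1, MonoidHom.one_apply, mul_one]

theorem OneParameter.cosetInvariant_mul_curve (ℓ : OneParameter x) (φ : EllisH) (s : ℝ) :
    cosetInvariant x (φ * ℓ.curve 1 s) =
      cosetInvariant x φ * (1, 1, Circle.exp (2 * Real.pi * s)) := by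
  rw [curve, cosetInvariant_mul_single_one, ℓ.apply_self]
  simp only [cosetInvariant, Prod.mk_mul_mk, mul_one]

theorem OneParameter.cosetInvariant_mul_curve_mul_curve (ℓ : OneParameter x) (φ : EllisH)
    (s t : ℝ) : cosetInvariant x (φ * ℓ.curve 1 s * ℓ.curve 1 t) =
      cosetInvariant x (φ * ℓ.curve 1 (s + t)) := by
  rw [cosetInvariant_mul_curve, cosetInvariant_mul_curve, cosetInvariant_mul_curve, mul_assoc]
  congr 1
  simp only [Prod.mk_mul_mk, mul_one, mul_add, Circle.exp_add]

theorem tildeH_apply (n : ℤ) (k : ℕ) (y : Circle) :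
    (tildeH n).1 k y = y ^ Ring.choose n k := rfl

/-- The invariants along a curve in the direction of the first coordinate. -/
theorem exists_cosetInvariant_tildeH_mul_single (n : ℕ) : ∃ c : Circle, ∀ (χ : EndT)
    (hχ : ∀ y ∈ TQ, χ y = 1), cosetInvariant x (tildeH n * single 0 χ hχ) =
      ((x ^ 2) ^ n * χ x ^ 2, fun y : TQ => (y : Circle) ^ n, c * χ x ^ (2 * (n / 2))) := by
  have hone : ∀ (χ : EndT) (hχ : ∀ y ∈ TQ, χ y = 1) y,
      (tildeH n * single 0 χ hχ).1 1 y = y ^ n * χ y := fun χ hχ y => by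
    have h1 : (single 0 χ hχ).1 1 = χ := single_apply_self 0 χ hχ
    rw [mul_apply_one, h1, tildeH_apply, Ring.choose_one_right, zpow_natCast]
  have htwo : ∀ (χ : EndT) (hχ : ∀ y ∈ TQ, χ y = 1),
      (tildeH n * single 0 χ hχ).1 2 x = x ^ Ring.choose (n : ℤ) 2 * χ x ^ n := fun χ hχ => by
    have h1 : (single 0 χ hχ).1 1 = χ := single_apply_self 0 χ hχ
    have h2 : (single 0 χ hχ).1 2 = 1 := single_apply_of_ne one_ne_zero χ hχ
    rw [mul_apply_two, h1, h2, tildeH_apply, tildeH_apply, Ring.choose_one_right, zpow_natCast,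
      MonoidHom.one_apply, mul_one]
  have hneg : negOne ^ 2 = 1 := by rw [pow_two, negOne_mul_self]
  rcases Nat.even_or_odd' n with ⟨k, hk | hk⟩
  · refine ⟨x ^ Ring.choose (n : ℤ) 2, fun χ hχ => ?_⟩
    rw [cosetInvariant, twisted_of_apply_negOne, htwo, hone, map_pow]
    · have h1 : 2 * (n / 2) = n := by omega
      rw [h1]
      congr 2
      exact funext fun y => by rw [hone, hχ y y.2, mul_one]
    · rw [hone, hχ _ negOne_mem_TQ, mul_one, hk, pow_mul, hneg, one_pow]
  · refine ⟨x ^ Ring.choose (n : ℤ) 2 * (x ^ n)⁻¹, fun χ hχ => ?_⟩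
    rw [cosetInvariant, twisted_of_apply_negOne', htwo, hone, hone, map_pow]
    · have h1 : 2 * (n / 2) = 2 * k := by omega
      have h2 : χ x ^ n = χ x ^ (2 * k) * χ x := by rw [hk, pow_succ]
      rw [h1, h2, mul_inv]
      congr 2
      · exact funext fun y => by rw [hone, hχ y y.2, mul_one]
      · calc x ^ Ring.choose (n : ℤ) 2 * (χ x ^ (2 * k) * χ x) * ((x ^ n)⁻¹ * (χ x)⁻¹)
            = x ^ Ring.choose (n : ℤ) 2 * (x ^ n)⁻¹ * χ x ^ (2 * k) * (χ x * (χ x)⁻¹) := by ac_rfl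
          _ = _ := by rw [mul_inv_cancel, mul_one]
    · rw [hone, hχ _ negOne_mem_TQ, mul_one, hk, pow_succ, pow_mul, hneg, one_pow, one_mul]

theorem OneParameter.exists_cosetInvariant_tildeH_mul_curve (ℓ : OneParameter x) (n : ℕ) :
    ∃ c : Circle, ∀ t, cosetInvariant x (tildeH n * ℓ.curve 0 (t / 2)) =
      ((x ^ 2) ^ n * Circle.exp (2 * Real.pi * t), fun y : TQ => (y : Circle) ^ n,
        c * Circle.exp (2 * Real.pi * ((n / 2 : ℕ) * t))) := by
  obtain ⟨c, h⟩ := exists_cosetInvariant_tildeH_mul_single (x := x) n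
  refine ⟨c, fun t => ?_⟩
  have hpow : ∀ k : ℕ, Circle.exp (2 * Real.pi * (t / 2)) ^ (2 * k) =
      Circle.exp (2 * Real.pi * (k * t)) := fun k => by
    rw [← Circle.exp_nsmul, nsmul_eq_mul]
    congr 1
    push_cast
    ring
  rw [curve, h, ℓ.apply_self, hpow (n / 2)]
  have h2 := hpow 1
  rw [mul_one, Nat.cast_one, one_mul] at h2
  rw [h2]

/-- Functions on the quotient are uniformly continuous with respect to the invariants. -/
theorem exists_nhds_of_invariant {g : EllisH → Circle} (hg : Continuous g)
    (hinv : ∀ φ ψ, cosetInvariant x φ = cosetInvariant x ψ → g φ = g ψ) {ε : ℝ} (hε : 0 < ε) :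
    ∃ U ∈ nhds (1 : Circle × (TQ → Circle) × Circle), ∀ φ ψ,
      cosetInvariant x φ / cosetInvariant x ψ ∈ U → ‖(g φ : ℂ) - g ψ‖ < ε := by
  let K : Set (EllisH × EllisH) := {p | ε ≤ ‖(g p.1 : ℂ) - g p.2‖}
  have hK : IsClosed K := isClosed_le continuous_const
    (((continuous_circle_coe.comp (hg.comp continuous_fst)).sub
      (continuous_circle_coe.comp (hg.comp continuous_snd))).norm)
  have hc : Continuous fun p : EllisH × EllisH => cosetInvariant x p.1 / cosetInvariant x p.2 :=
    ((continuous_cosetInvariant x).comp continuous_fst).div'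
      ((continuous_cosetInvariant x).comp continuous_snd)
  have hclosed := (hK.isCompact.image hc).isClosed
  refine ⟨_, hclosed.isOpen_compl.mem_nhds ?_, fun φ ψ h => ?_⟩
  · rintro ⟨⟨φ, ψ⟩, hK, h1⟩
    have h2 := hinv φ ψ (div_eq_one.1 h1)
    simp only [K, Set.mem_ofPred_eq, h2, sub_self, norm_zero] at hK
    exact absurd hK (not_le.2 hε)
  · by_contra hle
    exact h ⟨(φ, ψ), not_lt.1 hle, rfl⟩

end Curves

section NotQuasiDiscrete

variable {x : Circle} (ℓ : OneParameter x)

theorem OneParameter.exists_character {g : C(EllisH, Circle)}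
    (hinv : ∀ φ ψ, cosetInvariant x φ = cosetInvariant x ψ → g φ = g ψ)
    {m : ℕ} (hg : g ∈ quasiEigenfunctions T m) :
    ∃ E : ℤ, ∀ s φ, g (φ * ℓ.curve 1 s) = Circle.exp (2 * Real.pi * (E * s)) * g φ := by
  have hR : ∀ s, Continuous fun φ : EllisH => φ * ℓ.curve 1 s := fun s =>
    EllisH.continuous_mul_right _
  let R (s : ℝ) : C(EllisH, EllisH) := ⟨fun φ => φ * ℓ.curve 1 s, hR s⟩
  have hquot : ∀ s, g.comp (R s) * g⁻¹ ∈ quasiEigenfunctions T m := fun s =>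
    mul_mem_quasiEigenfunctions T m (comp_mem_quasiEigenfunctions (R s)
      (fun φ => by simp only [R, ContinuousMap.coe_mk, T_apply, mul_assoc]) hg)
      (inv_mem_quasiEigenfunctions T m hg)
  obtain ⟨U, hU, hUg⟩ := exists_nhds_of_invariant g.continuous hinv
    (show (0 : ℝ) < (1 / 2) ^ (m + 2) by positivity)
  have hcont : Continuous fun s : ℝ => ((1, 1, Circle.exp (2 * Real.pi * s)) :
      Circle × (TQ → Circle) × Circle) := by fun_prop
  have hnhds := hcont.continuousAt (x := 0) |>.preimage_mem_nhds (t := U) (by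
    rw [mul_zero, Circle.exp_zero]
    exact hU)
  obtain ⟨η, hη, hball⟩ := Metric.mem_nhds_iff.1 hnhds
  let S : AddSubmonoid ℝ :=
    { carrier := {s | ∃ c : Circle, ∀ φ, g (φ * ℓ.curve 1 s) = c * g φ}
      zero_mem' := ⟨1, fun φ => by
        rw [one_mul]
        refine hinv _ _ ?_
        rw [cosetInvariant_mul_curve, mul_zero, Circle.exp_zero]
        exact mul_one _⟩
      add_mem' := by
        rintro s t ⟨c, hs⟩ ⟨d, ht⟩
        refine ⟨d * c, fun φ => ?_⟩
        rw [← hinv _ _ (ℓ.cosetInvariant_mul_curve_mul_curve φ s t), ht, hs, mul_assoc] }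
  have hsmall : ∀ s, |s| < η → s ∈ S := fun s hs => by
    have hmem : ((1, 1, Circle.exp (2 * Real.pi * s)) : Circle × (TQ → Circle) × Circle) ∈ U :=
      hball (by simpa [Real.dist_eq] using hs)
    have h1 := isMinimalSystem_T.eq_of_quasiEigenfunction_near_one (hquot s) fun φ => by
      refine le_trans (le_of_eq (norm_coe_mul_inv_sub_one _ _)) (hUg (φ * ℓ.curve 1 s) φ ?_).le
      rwa [cosetInvariant_mul_curve, mul_div_cancel_left]
    refine ⟨g (1 * ℓ.curve 1 s) * (g 1)⁻¹, fun φ => ?_⟩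
    have h2 : g (φ * ℓ.curve 1 s) * (g φ)⁻¹ = g (1 * ℓ.curve 1 s) * (g 1)⁻¹ := h1 φ 1
    rw [← h2, inv_mul_cancel_right]
  have hall : ∀ s, s ∈ S := fun s => by
    obtain ⟨N, hN⟩ := exists_nat_gt (|s| / η)
    have hN0 : (0 : ℝ) < N := (by positivity : 0 ≤ |s| / η).trans_lt hN
    have h1 : s / N ∈ S := hsmall _ (by
      rw [abs_div, abs_of_pos hN0, div_lt_iff₀ hN0]
      rwa [div_lt_iff₀ hη, mul_comm] at hN)
    have h2 := S.nsmul_mem h1 N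
    rwa [nsmul_eq_mul, mul_div_cancel₀ _ hN0.ne'] at h2
  choose χ hχ using hall
  have hχ1 : ∀ s, χ s = g (ℓ.curve 1 s) * (g 1)⁻¹ := fun s => by
    rw [← one_mul (ℓ.curve 1 s), hχ, mul_inv_cancel_right]
  obtain ⟨E, hE⟩ := exists_exponent (χ := χ)
    (((g.continuous.comp (ℓ.continuous_curve 1)).mul continuous_const).congr fun s => (hχ1 s).symm)
    (fun s t => by
      have h := hinv _ _ (ℓ.cosetInvariant_mul_curve_mul_curve 1 s t)
      rw [hχ, hχ, hχ, ← mul_assoc] at h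
      rw [← mul_right_cancel h, mul_comm])
    (by
      have h : g (1 * ℓ.curve 1 1) = g 1 := hinv _ _ (by
        rw [cosetInvariant_mul_curve, mul_one, Circle.exp_two_pi]
        exact mul_one _)
      rw [hχ] at h
      exact mul_eq_right.1 h)
  exact ⟨E, fun s φ => by rw [hχ, hE]⟩

/-- A quasi-eigenfunction of the quotient does not distinguish opposite points. -/
theorem OneParameter.apply_curve_half {m : ℕ} {g : C(EllisH ⧸ exampleG x, Circle)}
    (hg : g ∈ quasiEigenfunctions (quotientT (exampleG x)) m) :
    g (ℓ.curve 1 (1 / 2) : EllisH) = g (1 : EllisH) := by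
  let π : C(EllisH, EllisH ⧸ exampleG x) := ⟨fun φ => φ, continuous_quot_mk⟩
  have hinv : ∀ φ ψ, cosetInvariant x φ = cosetInvariant x ψ → g.comp π φ = g.comp π ψ :=
    fun φ ψ h => congrArg g ((cosetInvariant_eq_iff x φ ψ).1 h)
  have hgπ := comp_mem_quasiEigenfunctions π (s := T) (fun _ => rfl) hg
  obtain ⟨E, hE⟩ := ℓ.exists_character hinv hgπ
  have hcurve : Continuous fun t : ℝ => ℓ.curve 0 (t / 2) :=
    (ℓ.continuous_curve 0).comp (continuous_id.div_const 2)
  have hdeg : ∀ n : ℕ, ∃ d, HasDegree (fun t => g.comp π (tildeH n * ℓ.curve 0 (t / 2))) d := by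
    intro n
    refine exists_hasDegree ((g.comp π).continuous.comp
      ((continuous_tildeH_mul n).comp hcurve)) fun t => hinv _ _ ?_
    obtain ⟨c, h⟩ := ℓ.exists_cosetInvariant_tildeH_mul_curve n
    have hper : ∀ k : ℕ, Circle.exp (2 * Real.pi * (k * (t + 1))) =
        Circle.exp (2 * Real.pi * (k * t)) := fun k =>
      Circle.exp_eq_exp.2 ⟨k, by push_cast; ring⟩
    have h1 := hper 1
    rw [Nat.cast_one, one_mul, one_mul] at h1
    rw [h, h, h1, hper]
  choose D hD using hdeg
  have hvanish : DifferencesVanish m D :=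
    differencesVanish_degree (P := fun n t => tildeH n * ℓ.curve 0 (t / 2)) (fun n t => by
      rw [T_apply, ← mul_assoc, tildeH_mul, add_comm]
      norm_cast) hgπ hD
  obtain ⟨U, hU, hUg⟩ := exists_nhds_of_invariant (g.comp π).continuous hinv one_pos
  have hcont : Continuous fun s : ℝ => ((Circle.exp (2 * Real.pi * s), 1, 1) :
      Circle × (TQ → Circle) × Circle) := by fun_prop
  have hnhds := hcont.continuousAt (x := 0) |>.preimage_mem_nhds (t := U) (by
    rw [mul_zero, Circle.exp_zero]
    exact hU)
  obtain ⟨η, hη, hball⟩ := Metric.mem_nhds_iff.1 hnhds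
  obtain ⟨N, hN⟩ := exists_nat_one_div_lt hη
  have hbound : ∀ n : ℕ, |D n - E * (n / 2 : ℕ)| ≤ (N + 1 : ℕ) := fun n => by
    have h1 : HasDegree (fun t => g.comp π (tildeH n * ℓ.curve 0 (t / 2) *
        ℓ.curve 1 (-((n / 2 : ℕ) * t)))) (D n - E * (n / 2 : ℕ)) := by
      have h2 := (hasDegree_exp (-(E * (n / 2 : ℕ)))).mul (hD n)
      rw [neg_add_eq_sub] at h2
      convert h2 using 2 with t
      rw [hE]
      congr 3
      rw [Int.cast_neg, Int.cast_mul, Int.cast_natCast]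
      ring
    refine h1.abs_le (Nat.succ_pos N) fun s t hst heq => ?_
    obtain ⟨c, hc⟩ := ℓ.exists_cosetInvariant_tildeH_mul_curve n
    have hline : ∀ r : ℝ, cosetInvariant x
        (tildeH n * ℓ.curve 0 (r / 2) * ℓ.curve 1 (-((n / 2 : ℕ) * r))) =
          ((x ^ 2) ^ n * Circle.exp (2 * Real.pi * r), fun y : TQ => (y : Circle) ^ n, c) := by
      intro r
      rw [cosetInvariant_mul_curve, hc, Prod.mk_mul_mk, Prod.mk_mul_mk, mul_one, mul_one,
        mul_assoc c, ← Circle.exp_add, mul_neg, add_neg_cancel, Circle.exp_zero, mul_one]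
    have h2 := hUg (tildeH n * ℓ.curve 0 (t / 2) * ℓ.curve 1 (-((n / 2 : ℕ) * t)))
      (tildeH n * ℓ.curve 0 (s / 2) * ℓ.curve 1 (-((n / 2 : ℕ) * s))) (by
        rw [hline, hline, Prod.mk_div_mk, Prod.mk_div_mk, div_self', div_self',
          mul_div_mul_left_eq_div, ← Circle.exp_sub, ← mul_sub]
        refine hball (a := t - s) ?_
        rw [Metric.mem_ball, Real.dist_eq, sub_zero]
        push_cast at hst
        exact hst.trans_lt hN)
    rw [heq, Circle.coe_mul, coe_negOne] at h2
    have h3 : ∀ z : ℂ, z * -1 - z = -2 * z := fun z => by ring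
    rw [h3, norm_mul, Circle.norm_coe] at h2
    norm_num at h2
  have heven : Even E := hvanish.even_of_bounded (C := 2 * (N + 1 : ℕ) + |E|) fun n => by
    have h1 := hbound n
    have h2 : (n : ℤ) = 2 * (n / 2 : ℕ) + (n % 2 : ℕ) := by omega
    have h3 : (n % 2 : ℕ) = 0 ∨ (n % 2 : ℕ) = 1 := by omega
    have h4 : 2 * D n - E * n = 2 * (D n - E * (n / 2 : ℕ)) - E * (n % 2 : ℕ) := by
      rw [h2]; ring
    rw [h4]
    refine (abs_sub _ _).trans (add_le_add ?_ ?_)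
    · rw [abs_mul, abs_two]
      linarith
    · rcases h3 with h3 | h3 <;> simp [h3]
  obtain ⟨k, rfl⟩ := heven
  have h1 := hE (1 / 2) 1
  have h2 : Circle.exp (2 * Real.pi * (((k + k : ℤ) : ℝ) * (1 / 2))) = 1 :=
    Circle.exp_eq_one.2 ⟨k, by push_cast; ring⟩
  rw [h2, one_mul, one_mul] at h1
  exact h1

end NotQuasiDiscrete

theorem not_hasQuasiDiscreteSpectrum_quotientT {x : Circle} (hx : x ∉ TQ) :
    ¬ HasQuasiDiscreteSpectrum (quotientT (exampleG x)) := by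
  intro h
  obtain ⟨ℓ⟩ := nonempty_oneParameter hx
  let f : C(EllisH ⧸ exampleG x, ℂ) :=
    ⟨Quotient.lift (fun φ => (twisted x φ : ℂ)) fun φ ψ hφψ => by
      have h1 := (cosetInvariant_eq_iff x φ ψ).2 (Quotient.sound hφψ)
      exact congrArg (fun c => (c.2.2 : ℂ)) h1,
    (continuous_circle_coe.comp (continuous_twisted x)).quotient_lift _⟩
  have h1 : (twisted x (ℓ.curve 1 (1 / 2)) : ℂ) = twisted x 1 :=
    h.apply_eq (fun m g hg => ℓ.apply_curve_half hg) f
  have h2 := congrArg (fun c => c.2.2) (ℓ.cosetInvariant_mul_curve 1 (1 / 2))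
  simp only [one_mul, cosetInvariant, Prod.mk_mul_mk] at h2
  rw [Circle.coe_injective h1, left_eq_mul] at h2
  refine negOne_ne_one (Eq.trans ?_ h2)
  rw [negOne]
  congr 1
  ring

end QDS

theorem mainTheorem8 :
    -- `(𝓗, T)` is a minimal system with quasi-discrete spectrum
    (CompactSpace QDS.EllisH ∧ T2Space QDS.EllisH ∧
      QDS.IsMinimalSystem QDS.T ∧ QDS.HasQuasiDiscreteSpectrum QDS.T) ∧
    -- the concrete counterexample, for every non-rational point of the circle
    (∃ x : Circle, x ∉ QDS.TQ) ∧
    (∀ x : Circle, x ∉ QDS.TQ →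
      IsClosed (QDS.exampleG x : Set QDS.EllisH) ∧
      T2Space (QDS.EllisH ⧸ QDS.exampleG x) ∧
      QDS.IsHomomorphism QDS.T (QDS.quotientT (QDS.exampleG x))
        (fun φ => (φ : QDS.EllisH ⧸ QDS.exampleG x)) ∧
      QDS.IsMinimalSystem (QDS.quotientT (QDS.exampleG x)) ∧
      QDS.IsDistal (QDS.quotientT (QDS.exampleG x)) ∧
      ¬ QDS.HasQuasiDiscreteSpectrum (QDS.quotientT (QDS.exampleG x)) ∧
      QDS.HasQuasiDiscreteSpectrum
        (QDS.leftTranslation (QDS.quotientT (QDS.exampleG x)))) ∧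
    -- quasi-discrete spectrum is not inherited by factors of minimal systems
    (∃ (X Y : Type) (_ : TopologicalSpace X) (_ : CompactSpace X) (_ : T2Space X)
      (_ : TopologicalSpace Y) (_ : CompactSpace Y) (_ : T2Space Y)
      (s : X ≃ₜ X) (t : Y ≃ₜ Y) (π : X → Y),
      QDS.IsMinimalSystem s ∧ QDS.HasQuasiDiscreteSpectrum s ∧
      QDS.IsHomomorphism s t π ∧ ¬ QDS.HasQuasiDiscreteSpectrum t) ∧
    -- quasi-discrete spectrum of the enveloping semigroup does not imply that of the system
    (∃ (X : Type) (_ : TopologicalSpace X) (_ : CompactSpace X) (_ : T2Space X) (s : X ≃ₜ X),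
      QDS.IsMinimalSystem s ∧ QDS.IsDistal s ∧
      QDS.HasQuasiDiscreteSpectrum (QDS.leftTranslation s) ∧
      ¬ QDS.HasQuasiDiscreteSpectrum s) := by
  obtain ⟨x, hx⟩ := QDS.exists_notMem_TQ
  have hπ := fun x => QDS.isHomomorphism_mk (QDS.exampleG x)
  have hmin := fun x => QDS.isMinimalSystem_T.of_isHomomorphism (hπ x)
  refine ⟨⟨inferInstance, inferInstance, QDS.isMinimalSystem_T, QDS.hasQuasiDiscreteSpectrum_T⟩,
    ⟨x, hx⟩, fun x hx => ⟨QDS.isClosed_exampleG x, inferInstance, hπ x, hmin x,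
      QDS.isDistal_quotientT _, QDS.not_hasQuasiDiscreteSpectrum_quotientT hx,
      QDS.hasQuasiDiscreteSpectrum_leftTranslation hx⟩,
    ⟨QDS.EllisH, QDS.EllisH ⧸ QDS.exampleG x, inferInstance, inferInstance, inferInstance,
      inferInstance, inferInstance, inferInstance, QDS.T, QDS.quotientT _, _,
      QDS.isMinimalSystem_T, QDS.hasQuasiDiscreteSpectrum_T, hπ x,
      QDS.not_hasQuasiDiscreteSpectrum_quotientT hx⟩,
    ⟨QDS.EllisH ⧸ QDS.exampleG x, inferInstance, inferInstance, inferInstance, QDS.quotientT _,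
      hmin x, QDS.isDistal_quotientT _, QDS.hasQuasiDiscreteSpectrum_leftTranslation hx,
      QDS.not_hasQuasiDiscreteSpectrum_quotientT hx⟩⟩
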